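/- **Setting.** Let $T$ be a real function, $\mathfrak c\in[0,1]$, $\Delta=T(\mathfrak c)$, $\Gamma=1-\Delta$, $\tilde I=[-\Gamma,1]$, and $d_1<d_2$ with $[d_1,d_2]\subset[0,1]$. Assume: * (A) $T$ is continuous on $\tilde I$, maps $[0,1]$ into $[0,1]$, $T(x)<\Delta<1$ for all $x\in[0,1]\setminus\{\mathfrak c\}$, and $T$ is decreasing (not necessarily strictly) on $[-\Gamma,0]$ with $T(-\Gamma)<\Delta$. The interval $[d_1,d_2]$ is forward invariant, and $T^k|_{[d_1,d_2]}$ is topologically transitive for every $k\ge1$. For Lebesgue-a.e. $x\in[0,1]$ the orbit of $x$ under $T$ enters every neighbourhood of $[d_1,d_2]$. There is exactly one $T$-invariant Borel probability measure on $[0,1]$ that is absolutely continuous with respect to Lebesgue measure. * (B) For $n\ge1$, $\sigma_n:\tilde I\to[0,\infty)$ is continuous, differentiable on $(0,1)$ and positive on $\tilde I\setminus\{0,1\}$, and $\sigma_n(x)\to0$ as $n\to\infty$ for every $x\in\tilde I$. Fix $n\ge1$ and $a>0$, put $\sigma_{\max}=\max_{\tilde I}\sigma_n$, and assume one of the following.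 * (B1) $T(0)=0$, $\sigma_n(0)=0$, $a\le\frac1{\sigma_{\max}}\frac{\Gamma}{2}$, and there is $\varepsilon\in(0,1-\frac\Gamma2)$ such that $T-a\sigma_n>0$ on $(0,1-\frac\Gamma2]$, $T(x)-a\sigma_n(x)>x$ for $x\in(0,\varepsilon)$, and $T-a\sigma_n>\varepsilon$ on $(\varepsilon,1-\frac\Gamma2)$. * (B2) $T(0)=q>0$, $a\le\frac1{\sigma_{\max}}\min\{\frac\Gamma2,\frac q2,\frac12T(1-\frac\Gamma2)\}$, and $T-a\sigma_n>0$ on $(0,1-\frac\Gamma2]$ (the last condition is automatic if $T$ is monotone on each side of $\mathfrak c$). * (C) The noise variables $Y_t$ are i.i.d. with density $g_a(y)=c_a\chi(y)e^{-y^2/2}$, where $\chi\ge0$ is $C^\infty$ with support $[-a,a]$ and $c_a=(\int\chi(y)e^{-y^2/2}dy)^{-1}$. Consider the Markov chain $X_{t+1}=T(X_t)+\sigma_n(X_t)Y_{t+1}$ on $\tilde I$, with transition probabilities $P_x=\mathrm{Law}(T(x)+\sigma_n(x)Y_1)$, and the Markov operator on densities $$(\mathcal Lf)(y)=\int_{\tilde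 I}p_n(x,y)f(x)\,dx,\qquad p_n(x,y)=\frac1{\sigma_n(x)}\,g_a\!\left(\frac{y-T(x)}{\sigma_n(x)}\right).$$ **Statement.** The chain has a stationary probability measure $\mu_n$ on $\tilde I$ which is absolutely continuous with a density $h_n\ge0$ of bounded variation on $\tilde I$, and $[d_1,d_2]\subset\operatorname{supp}\mu_n$. It is the only stationary probability measure on $\tilde I$ if $T(0)>0$, and the only one that gives no mass to the fixed point $0$ if $T(0)=0$; in particular it is the only absolutely continuous one in both cases. Moreover, let $J=[\varepsilon,1-\frac\Gamma2]$ in case (B1), for any $\varepsilon$ as there, and $J=\tilde I$ in case (B2). There are $0<r<1$ and $C>0$ such that for all $f\in L^1(J)$ (extended by $0$), all $g$ of bounded variation on $J$ and all integers $t\ge0$, the function $(\mathcal L^tf)g$ is integrable on $J$ and $$\Big|\int_J(\mathcal L^tf)(x)\,g(x)\,dx-\int_J f\,dx\int_J g\,d\mu_n\Big|\le C\,r^t\,\|f\|_1\,\|g\|_{BV},\qquad \|g\|_{BV}=|g|_{TV,J}+\|g\|_{L^1(J)}.$$ -/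

import Mathlib

open MeasureTheory Set Filter Topology

namespace HeteroChain

noncomputable section

/-- The gap between the maximal value `T c` of the map and `1`. -/
def gap (T : ℝ → ℝ) (c : ℝ) : ℝ := 1 - T c

/-- The enlarged state space `[-Γ, 1]`. -/
def stateSpace (T : ℝ → ℝ) (c : ℝ) : Set ℝ := Icc (-(gap T c)) 1

/-- Topological transitivity of the restriction of `S` to the (forward invariant) subspace `X`. -/
def TransitiveOn (S : ℝ → ℝ) (X : Set ℝ) : Prop :=
  ∀ U V : Set ℝ, IsOpen U → IsOpen V → (U ∩ X).Nonempty → (V ∩ X).Nonempty →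
    ∃ t : ℕ, (S^[t] ⁻¹' U ∩ (V ∩ X)).Nonempty

/-- The assumptions on the deterministic map, a self-map of `[0, 1]` extended to `[-Γ, 1]`. -/
structure IsAdmissibleMap (T : ℝ → ℝ) (c d₁ d₂ : ℝ) : Prop where
  mapsTo : MapsTo T (Icc 0 1) (Icc 0 1)
  max_mem : c ∈ Icc (0 : ℝ) 1
  max_unique : ∀ x ∈ Icc (0 : ℝ) 1, x ≠ c → T x < T c
  max_lt_one : T c < 1
  -- the extension to `[-Γ, 0]` is continuous and decreasing, and stays below the maximum
  continuousOn : ContinuousOn T (stateSpace T c)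
  antitoneOn : AntitoneOn T (Icc (-(gap T c)) 0)
  left_lt : T (-(gap T c)) < T c
  -- the transitive interval
  lt : d₁ < d₂
  subset : Icc d₁ d₂ ⊆ Icc (0 : ℝ) 1
  forward_invariant : MapsTo T (Icc d₁ d₂) (Icc d₁ d₂)
  transitive : ∀ k : ℕ, 1 ≤ k → TransitiveOn (T^[k]) (Icc d₁ d₂)
  -- there is no other attracting component: typical orbits come arbitrarily close to `[d₁, d₂]`
  absorbing : ∀ᵐ x ∂(volume.restrict (Icc (0 : ℝ) 1)),
    ∀ U : Set ℝ, IsOpen U → Icc d₁ d₂ ⊆ U → ∃ k : ℕ, T^[k] x ∈ U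
  -- the unique absolutely continuous invariant probability measure
  unique_acip : ∃! η : Measure ℝ, IsProbabilityMeasure η ∧ η (Icc (0 : ℝ) 1)ᶜ = 0 ∧
    η.map T = η ∧ η ≪ volume

/-- The maximal value of the noise amplitude on the state space. -/
def sigmaMax (T : ℝ → ℝ) (c : ℝ) (s : ℝ → ℝ) : ℝ := sSup (s '' stateSpace T c)

/-- The assumptions on the noise amplitudes `σ n`. -/
structure IsNoiseAmplitude (T : ℝ → ℝ) (c : ℝ) (σ : ℕ → ℝ → ℝ) : Prop where
  continuousOn : ∀ n, 1 ≤ n → ContinuousOn (σ n) (stateSpace T c)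
  differentiableOn : ∀ n, 1 ≤ n → DifferentiableOn ℝ (σ n) (Ioo 0 1)
  nonneg : ∀ n, 1 ≤ n → ∀ x ∈ stateSpace T c, 0 ≤ σ n x
  -- only the points `0` and `1` may be free of noise
  pos : ∀ n, 1 ≤ n → ∀ x ∈ stateSpace T c, x ≠ 0 → x ≠ 1 → 0 < σ n x
  tendsto_zero : ∀ x ∈ stateSpace T c, Tendsto (fun n => σ n x) atTop (𝓝 0)

/-- Compatibility of map, amplitude and noise range `a` when `0` is a fixed point of `T`. -/
structure FixedOriginCase (T : ℝ → ℝ) (c : ℝ) (s : ℝ → ℝ) (a ε : ℝ) : Prop where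
  map_zero : T 0 = 0
  sigma_zero : s 0 = 0
  bound : a ≤ 1 / sigmaMax T c s * (gap T c / 2)
  eps_pos : 0 < ε
  eps_lt : ε < 1 - gap T c / 2
  lower_pos : ∀ x ∈ Ioc 0 (1 - gap T c / 2), 0 < T x - a * s x
  lower_gt_self : ∀ x ∈ Ioo 0 ε, x < T x - a * s x
  lower_gt_eps : ∀ x ∈ Ioo ε (1 - gap T c / 2), ε < T x - a * s x

/-- Compatibility of map, amplitude and noise range `a` when `T 0 > 0`. The last condition is
automatic if `T` is monotone on both sides of its maximum. -/
structure PositiveInterceptCase (T : ℝ → ℝ) (c : ℝ) (s : ℝ → ℝ) (a : ℝ) : Prop where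
  map_zero_pos : 0 < T 0
  bound : a ≤ 1 / sigmaMax T c s *
    min (gap T c / 2) (min (T 0 / 2) (T (1 - gap T c / 2) / 2))
  lower_pos : ∀ x ∈ Ioc 0 (1 - gap T c / 2), 0 < T x - a * s x

/-- `χ` is a smooth bump function on `[-a, a]`. -/
structure IsBump (χ : ℝ → ℝ) (a : ℝ) : Prop where
  smooth : ContDiff ℝ ((⊤ : ℕ∞) : WithTop ℕ∞) χ
  nonneg : ∀ y, 0 ≤ χ y
  tsupport_eq : tsupport χ = Icc (-a) a

/-- The noise density `g_a(y) = c_a χ(y) exp(-y²/2)`. -/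
def noiseDensity (χ : ℝ → ℝ) (y : ℝ) : ℝ :=
  (∫ u, χ u * Real.exp (-u ^ 2 / 2))⁻¹ * (χ y * Real.exp (-y ^ 2 / 2))

/-- The law of each of the i.i.d. noise variables. -/
def noiseLaw (χ : ℝ → ℝ) : Measure ℝ :=
  volume.withDensity fun y => ENNReal.ofReal (noiseDensity χ y)

/-- The transition probability from `x`: the law of `T x + σ x * Y`. -/
def transition (T s χ : ℝ → ℝ) (x : ℝ) : Measure ℝ :=
  (noiseLaw χ).map fun y => T x + s x * y

/-- The map, the amplitude with index `n` and the noise form a random system. -/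
structure IsRandomSystem (T : ℝ → ℝ) (c d₁ d₂ : ℝ) (σ : ℕ → ℝ → ℝ) (χ : ℝ → ℝ) (a : ℝ)
    (n : ℕ) : Prop where
  map : IsAdmissibleMap T c d₁ d₂
  amplitude : IsNoiseAmplitude T c σ
  index_pos : 1 ≤ n
  a_pos : 0 < a
  bump : IsBump χ a
  cases : (∃ ε, FixedOriginCase T c (σ n) a ε) ∨ PositiveInterceptCase T c (σ n) a

/-- `ν` is a stationary probability measure of the Markov chain on `[-Γ, 1]`. -/
structure IsStationary (T : ℝ → ℝ) (c : ℝ) (s χ : ℝ → ℝ) (ν : Measure ℝ) : Prop where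
  prob : IsProbabilityMeasure ν
  concentrated : ν (stateSpace T c)ᶜ = 0
  stationary : ∀ A : Set ℝ, MeasurableSet A → ∫⁻ x, transition T s χ x A ∂ν = ν A

/-- The stochastic kernel `p(x, y)`, the density of the transition probability where `s x > 0`. -/
def kernelDensity (T s χ : ℝ → ℝ) (x y : ℝ) : ℝ :=
  (s x)⁻¹ * noiseDensity χ ((y - T x) / s x)

/-- The Markov operator on densities. -/
def markovOp (T : ℝ → ℝ) (c : ℝ) (s χ : ℝ → ℝ) (f : ℝ → ℝ) (y : ℝ) : ℝ :=
  ∫ x in stateSpace T c, kernelDensity T s χ x y * f x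

/-- The norm `|g|_TV + ‖g‖₁` of a function of bounded variation on `J`. -/
def bvNorm (g : ℝ → ℝ) (J : Set ℝ) : ℝ :=
  (eVariationOn g J).toReal + ∫ x in J, |g x|

/-- Exponential decay of correlations on `J`, for `f ∈ L¹(J)` (extended by zero) and
`g ∈ BV(J)`. -/
def ExponentialDecayOn (T : ℝ → ℝ) (c : ℝ) (s χ : ℝ → ℝ) (μ : Measure ℝ) (J : Set ℝ) : Prop :=
  ∃ r C : ℝ, 0 < r ∧ r < 1 ∧ 0 < C ∧
    ∀ f g : ℝ → ℝ, Integrable f → Function.support f ⊆ J → BoundedVariationOn g J →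
      ∀ t : ℕ,
        IntegrableOn (fun x => ((markovOp T c s χ)^[t] f) x * g x) J ∧
        |(∫ x in J, ((markovOp T c s χ)^[t] f) x * g x) - (∫ x, f x) * ∫ x in J, g x ∂μ| ≤
          C * r ^ t * (∫ x, |f x|) * bvNorm g J

end

end HeteroChain

namespace HeteroChain

noncomputable section

/-! ### The noise -/

section Noise

variable {χ : ℝ → ℝ} {a : ℝ}

/-! The proof works with the dual operator `stepOp`, `Q φ(x) = 𝔼 φ(T x + σ(x) Y)`, on bounded
measurable functions, and establishes Doeblin's condition for it on a compact interval `K = [α, 1 -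
Γ/2]` inside `(0, 1)` that the chain cannot leave. On `K` the amplitude is bounded below, so the
kernel is bounded and Lipschitz in its second variable. Extending map and amplitude from `K` by
constants makes the whole line enter `K` in one step (`IsTrapped`).

Zero noise follows orbits of `T`, almost every orbit in `K` comes close to `[d₁, d₂]`, and `T` is
transitive there; since the noise spreads over an open set, every point reaches every open set that
meets `[d₁, d₂]` (`exists_mem_iterate_preReach`). For a small ball about a fixed point of `T` in
`[d₁, d₂]`, compactness gives a common time, and one more step from that ball has a density bounded
below on another ball (`exists_minorization`). So some power of `Q` contracts oscillations, `Q^t φ`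
converges uniformly and exponentially to a constant, and the limits for `φ = p(·, y)` form a
Lipschitz stationary density (`exists_density`). Reachability puts `[d₁, d₂]` into its support.

Decay of correlations follows from the duality `∫ (𝓛^t f) g = ∫ f Q^t g`; bounded variation of `g`
enters only through measurability and a sup bound. Uniqueness follows from `∫ φ dν = ∫ Q^t φ dν → ∫
φ dμ` for stationary `ν` living on `K`. It remains to find `K` and to show that stationary measures
live there. If `T 0 > 0`, every state enters `K` within two steps. If `T 0 = 0`, then `α = ε`, and
two functions that do not decrease in mean along the chain, the indicator of `(0, ∞)` and `max 0
(min x ε)`, must be invariant almost everywhere, which excludes mass below `ε` other than at `0`. -/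

theorem IsBump.eq_zero (hχ : IsBump χ a) {y : ℝ} (hy : y ∉ Icc (-a) a) : χ y = 0 :=
  image_eq_zero_of_notMem_tsupport (hχ.tsupport_eq ▸ hy)

theorem IsBump.hasCompactSupport (hχ : IsBump χ a) : HasCompactSupport χ := by
  rw [HasCompactSupport, hχ.tsupport_eq]; exact isCompact_Icc

/-- Every open set meeting `[-a, a]` contains a point where `χ` is positive. -/
theorem IsBump.exists_pos (hχ : IsBump χ a) {V : Set ℝ} (hV : IsOpen V)
    (hne : (V ∩ Icc (-a) a).Nonempty) : ∃ y ∈ V, 0 < χ y := by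
  obtain ⟨x, hxV, hx⟩ := hne
  rw [← hχ.tsupport_eq] at hx
  obtain ⟨y, hyV, hy⟩ := mem_closure_iff.1 hx V hV hxV
  exact ⟨y, hyV, lt_of_le_of_ne (hχ.nonneg y) (Ne.symm hy)⟩

theorem IsBump.contDiff_weight (hχ : IsBump χ a) :
    ContDiff ℝ ((⊤ : ℕ∞) : WithTop ℕ∞) fun u => χ u * Real.exp (-u ^ 2 / 2) := by
  have := hχ.smooth
  fun_prop

theorem IsBump.hasCompactSupport_weight (hχ : IsBump χ a) :
    HasCompactSupport fun u => χ u * Real.exp (-u ^ 2 / 2) :=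
  hχ.hasCompactSupport.mul_right

theorem IsBump.integral_weight_pos (hχ : IsBump χ a) (ha : 0 < a) :
    0 < ∫ u, χ u * Real.exp (-u ^ 2 / 2) := by
  obtain ⟨y, -, hy⟩ := hχ.exists_pos isOpen_univ ⟨0, mem_univ _, by constructor <;> linarith⟩
  refine hχ.contDiff_weight.continuous.integral_pos_of_hasCompactSupport_nonneg_nonzero (x := y)
    hχ.hasCompactSupport_weight (fun u => mul_nonneg (hχ.nonneg u) (Real.exp_pos _).le) ?_
  exact (mul_pos hy (Real.exp_pos _)).ne'

theorem IsBump.noiseDensity_nonneg (hχ : IsBump χ a) (y : ℝ) : 0 ≤ noiseDensity χ y := by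
  refine mul_nonneg (inv_nonneg.2 (integral_nonneg fun u => ?_)) ?_ <;>
  exact mul_nonneg (hχ.nonneg _) (Real.exp_pos _).le

theorem IsBump.noiseDensity_pos (hχ : IsBump χ a) (ha : 0 < a) {y : ℝ} (hy : 0 < χ y) :
    0 < noiseDensity χ y :=
  mul_pos (inv_pos.2 (hχ.integral_weight_pos ha)) (mul_pos hy (Real.exp_pos _))

theorem IsBump.noiseDensity_eq_zero (hχ : IsBump χ a) {y : ℝ} (hy : y ∉ Icc (-a) a) :
    noiseDensity χ y = 0 := by
  simp [noiseDensity, hχ.eq_zero hy]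

theorem IsBump.hasCompactSupport_noiseDensity (hχ : IsBump χ a) :
    HasCompactSupport (noiseDensity χ) :=
  hχ.hasCompactSupport_weight.mul_left

theorem IsBump.contDiff_noiseDensity (hχ : IsBump χ a) :
    ContDiff ℝ ((⊤ : ℕ∞) : WithTop ℕ∞) (noiseDensity χ) :=
  contDiff_const.mul hχ.contDiff_weight

theorem IsBump.continuous_noiseDensity (hχ : IsBump χ a) : Continuous (noiseDensity χ) :=
  hχ.contDiff_noiseDensity.continuous

theorem IsBump.exists_lipschitz_noiseDensity (hχ : IsBump χ a) :
    ∃ K, LipschitzWith K (noiseDensity χ) :=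
  ContDiff.lipschitzWith_of_hasCompactSupport hχ.hasCompactSupport_noiseDensity
    hχ.contDiff_noiseDensity (by simp)

theorem IsBump.exists_noiseDensity_le (hχ : IsBump χ a) :
    ∃ K, 0 < K ∧ ∀ y, noiseDensity χ y ≤ K := by
  obtain ⟨K, hK⟩ := hχ.hasCompactSupport_noiseDensity.exists_bound_of_continuous
    hχ.continuous_noiseDensity
  refine ⟨max K 1, by positivity, fun y => ?_⟩
  exact ((le_abs_self _).trans (hK y)).trans (le_max_left _ _)

theorem IsBump.integrable_noiseDensity (hχ : IsBump χ a) : Integrable (noiseDensity χ) :=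
  hχ.continuous_noiseDensity.integrable_of_hasCompactSupport hχ.hasCompactSupport_noiseDensity

theorem IsBump.integral_noiseDensity (hχ : IsBump χ a) (ha : 0 < a) :
    ∫ y, noiseDensity χ y = 1 := by
  simp only [noiseDensity]
  rw [integral_const_mul]
  exact inv_mul_cancel₀ (hχ.integral_weight_pos ha).ne'

theorem IsBump.isProbabilityMeasure (hχ : IsBump χ a) (ha : 0 < a) :
    IsProbabilityMeasure (noiseLaw χ) := by
  constructor
  rw [noiseLaw, withDensity_apply _ MeasurableSet.univ, Measure.restrict_univ,
    ← ofReal_integral_eq_lintegral_ofReal hχ.integrable_noiseDensity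
      (ae_of_all _ hχ.noiseDensity_nonneg), hχ.integral_noiseDensity ha, ENNReal.ofReal_one]

theorem IsBump.integral_noiseLaw (hχ : IsBump χ a) (φ : ℝ → ℝ) :
    ∫ u, φ u ∂noiseLaw χ = ∫ u, noiseDensity χ u * φ u := by
  rw [noiseLaw, integral_withDensity_eq_integral_toReal_smul
    hχ.continuous_noiseDensity.measurable.ennreal_ofReal (by simp)]
  simp [ENNReal.toReal_ofReal (hχ.noiseDensity_nonneg _)]

theorem IsBump.ae_mem (hχ : IsBump χ a) : ∀ᵐ u ∂noiseLaw χ, u ∈ Icc (-a) a := by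
  rw [noiseLaw, ae_withDensity_iff hχ.continuous_noiseDensity.measurable.ennreal_ofReal]
  refine ae_of_all _ fun u hu => ?_
  by_contra h
  exact hu (by simp [hχ.noiseDensity_eq_zero h])

/-- `χ` may vanish at points of `[-a, a]`, but its positivity set is dense there, so an open set
meeting the interval contains an open piece on which the density is positive. -/
theorem IsBump.noiseLaw_pos (hχ : IsBump χ a) (ha : 0 < a) {V : Set ℝ} (hV : IsOpen V)
    (hne : (V ∩ Icc (-a) a).Nonempty) : 0 < noiseLaw χ V := by
  obtain ⟨y, hyV, hy⟩ := hχ.exists_pos hV hne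
  rw [pos_iff_ne_zero]
  intro h0
  rw [noiseLaw, withDensity_apply _ hV.measurableSet,
    lintegral_eq_zero_iff hχ.continuous_noiseDensity.measurable.ennreal_ofReal] at h0
  have h1 : ∀ᵐ u, ¬ (u ∈ V ∧ 0 < noiseDensity χ u) := by
    filter_upwards [(ae_restrict_iff' hV.measurableSet).1 h0] with u hu ⟨huV, hp⟩
    have := hu huV
    simp only [Pi.zero_apply, ENNReal.ofReal_eq_zero] at this
    linarith
  have ho : IsOpen (V ∩ {u | 0 < noiseDensity χ u}) :=
    hV.inter (isOpen_lt continuous_const hχ.continuous_noiseDensity)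
  have := ho.measure_pos volume ⟨y, hyV, hχ.noiseDensity_pos ha hy⟩
  rw [ae_iff] at h1
  simp only [not_not] at h1
  exact this.ne' h1

end Noise

/-! ### The Markov operator on bounded functions -/

/-- The Markov operator on functions, `(Q φ)(x) = 𝔼 φ(T x + s x Y)`. -/
def stepOp (T s χ : ℝ → ℝ) (φ : ℝ → ℝ) (x : ℝ) : ℝ :=
  ∫ u, φ (T x + s x * u) ∂noiseLaw χ

section StepOp

variable {T s χ : ℝ → ℝ} {a : ℝ} {φ ψ : ℝ → ℝ}

theorem integrable_of_measurable_of_abs_le {μ : Measure ℝ} [IsFiniteMeasure μ] {D : ℝ}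
    (hφ : Measurable φ) (hD : ∀ x, |φ x| ≤ D) : Integrable φ μ :=
  Integrable.of_bound hφ.aestronglyMeasurable D (ae_of_all _ hD)

theorem integrable_shift [IsProbabilityMeasure (noiseLaw χ)] {D : ℝ} (hφ : Measurable φ)
    (hD : ∀ x, |φ x| ≤ D) (x : ℝ) :
    Integrable (fun u => φ (T x + s x * u)) (noiseLaw χ) :=
  integrable_of_measurable_of_abs_le (by fun_prop) fun _ => hD _

theorem measurable_stepOp [IsProbabilityMeasure (noiseLaw χ)] (hT : Measurable T)
    (hs : Measurable s) (hφ : Measurable φ) : Measurable (stepOp T s χ φ) := by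
  have : Measurable fun p : ℝ × ℝ => φ (T p.1 + s p.1 * p.2) := by fun_prop
  exact this.stronglyMeasurable.integral_prod_right'.measurable

theorem abs_stepOp_le [IsProbabilityMeasure (noiseLaw χ)] {D : ℝ} (hD : ∀ x, |φ x| ≤ D) (x : ℝ) :
    |stepOp T s χ φ x| ≤ D := by
  have := norm_integral_le_of_norm_le_const (μ := noiseLaw χ)
    (f := fun u => φ (T x + s x * u)) (ae_of_all _ fun u => hD _)
  simpa [stepOp] using this

theorem measurable_iterate_stepOp [IsProbabilityMeasure (noiseLaw χ)] (hT : Measurable T)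
    (hs : Measurable s) (hφ : Measurable φ) (t : ℕ) : Measurable ((stepOp T s χ)^[t] φ) := by
  induction t with
  | zero => exact hφ
  | succ t ih => rw [Function.iterate_succ_apply']; exact measurable_stepOp hT hs ih

theorem abs_iterate_stepOp_le [IsProbabilityMeasure (noiseLaw χ)] {D : ℝ} (hD : ∀ x, |φ x| ≤ D)
    (t : ℕ) (x : ℝ) : |(stepOp T s χ)^[t] φ x| ≤ D := by
  induction t generalizing x with
  | zero => exact hD x
  | succ t ih => rw [Function.iterate_succ_apply']; exact abs_stepOp_le ih x

theorem continuous_stepOp [IsProbabilityMeasure (noiseLaw χ)] (hT : Continuous T)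
    (hs : Continuous s) (hφ : Continuous φ) {D : ℝ} (hD : ∀ x, |φ x| ≤ D) :
    Continuous (stepOp T s χ φ) := by
  refine continuous_of_dominated (bound := fun _ => D) (fun x => ?_)
    (fun x => ae_of_all _ fun u => hD _) (integrable_const _) (ae_of_all _ fun u => by fun_prop)
  exact Continuous.aestronglyMeasurable (by fun_prop)

theorem continuous_iterate_stepOp [IsProbabilityMeasure (noiseLaw χ)] (hT : Continuous T)
    (hs : Continuous s) (hφ : Continuous φ) {D : ℝ} (hD : ∀ x, |φ x| ≤ D) (t : ℕ) :
    Continuous ((stepOp T s χ)^[t] φ) := by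
  induction t with
  | zero => exact hφ
  | succ t ih =>
    rw [Function.iterate_succ_apply']
    exact continuous_stepOp hT hs ih (abs_iterate_stepOp_le hD t)

theorem iterate_stepOp_mono [IsProbabilityMeasure (noiseLaw χ)] (hT : Measurable T)
    (hs : Measurable s) (hφ : Measurable φ) (hψ : Measurable ψ) {D E : ℝ} (hD : ∀ x, |φ x| ≤ D)
    (hE : ∀ x, |ψ x| ≤ E) (h : ∀ x, φ x ≤ ψ x) (t : ℕ) (x : ℝ) :
    (stepOp T s χ)^[t] φ x ≤ (stepOp T s χ)^[t] ψ x := by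
  induction t generalizing x with
  | zero => exact h x
  | succ t ih =>
    simp only [Function.iterate_succ_apply']
    exact integral_mono
      (integrable_shift (measurable_iterate_stepOp hT hs hφ t) (abs_iterate_stepOp_le hD t) x)
      (integrable_shift (measurable_iterate_stepOp hT hs hψ t) (abs_iterate_stepOp_le hE t) x)
      fun u => ih _

theorem iterate_stepOp_affine [IsProbabilityMeasure (noiseLaw χ)] (hT : Measurable T)
    (hs : Measurable s) (hφ : Measurable φ) {D : ℝ} (hD : ∀ x, |φ x| ≤ D) (k m : ℝ) (t : ℕ)
    (x : ℝ) : (stepOp T s χ)^[t] (fun y => k * φ y + m) x = k * (stepOp T s χ)^[t] φ x + m := by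
  induction t generalizing x with
  | zero => rfl
  | succ t ih =>
    simp only [Function.iterate_succ_apply']
    rw [stepOp, stepOp]
    simp only [ih]
    rw [integral_add ((integrable_shift (measurable_iterate_stepOp hT hs hφ t)
      (abs_iterate_stepOp_le hD t) x).const_mul k) (integrable_const _), integral_const_mul]
    simp

theorem iterate_stepOp_const [IsProbabilityMeasure (noiseLaw χ)] (m : ℝ) (t : ℕ) :
    (stepOp T s χ)^[t] (fun _ => m) = fun _ => m := by
  induction t with
  | zero => rfl
  | succ t ih => rw [Function.iterate_succ_apply', ih]; funext x; simp [stepOp]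

/-- If `φ` takes values in `[m, M]`, then so does every iterate. -/
theorem iterate_stepOp_mem_Icc [IsProbabilityMeasure (noiseLaw χ)] (hT : Measurable T)
    (hs : Measurable s) (hφ : Measurable φ) {m M : ℝ} (h : ∀ x, φ x ∈ Icc m M) (t : ℕ) (x : ℝ) :
    (stepOp T s χ)^[t] φ x ∈ Icc m M := by
  have hD : ∀ x, |φ x| ≤ max |m| |M| := fun x => abs_le_max_abs_abs (h x).1 (h x).2
  constructor
  · have := iterate_stepOp_mono (χ := χ) hT hs measurable_const hφ (fun _ => le_rfl) hD
      (fun x => (h x).1) t x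
    rwa [iterate_stepOp_const] at this
  · have := iterate_stepOp_mono (χ := χ) hT hs hφ measurable_const hD (fun _ => le_rfl)
      (fun x => (h x).2) t x
    rwa [iterate_stepOp_const] at this

/-- The value of `Q φ` at `x` only depends on `φ` on the points reached from `x`. -/
theorem stepOp_congr {T' s' : ℝ → ℝ} (hχ : IsBump χ a) {x : ℝ}
    (h : ∀ u ∈ Icc (-a) a, φ (T x + s x * u) = ψ (T' x + s' x * u)) :
    stepOp T s χ φ x = stepOp T' s' χ ψ x :=
  integral_congr_ae (hχ.ae_mem.mono h)

/-- A chain started in the invariant set `K` never sees anything outside it. This allows different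
extensions of map and amplitude to be exchanged. -/
theorem iterate_stepOp_congr {T' s' : ℝ → ℝ} (hχ : IsBump χ a) {K : Set ℝ} (hT : EqOn T T' K)
    (hs : EqOn s s' K) (hK : ∀ x ∈ K, ∀ u ∈ Icc (-a) a, T x + s x * u ∈ K) (hφ : EqOn φ ψ K)
    (t : ℕ) : EqOn ((stepOp T s χ)^[t] φ) ((stepOp T' s' χ)^[t] ψ) K := by
  induction t with
  | zero => exact hφ
  | succ t ih =>
    intro x hx
    simp only [Function.iterate_succ_apply']
    refine stepOp_congr hχ fun u hu => ?_
    rw [← hT hx, ← hs hx]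
    exact ih (hK x hx u hu)

theorem measurable_kernelDensity (hχ : IsBump χ a) (hT : Measurable T) (hs : Measurable s) :
    Measurable fun p : ℝ × ℝ => kernelDensity T s χ p.1 p.2 := by
  have := hχ.continuous_noiseDensity.measurable
  unfold kernelDensity
  fun_prop

theorem kernelDensity_nonneg (hχ : IsBump χ a) {x : ℝ} (hx : 0 ≤ s x) (y : ℝ) :
    0 ≤ kernelDensity T s χ x y :=
  mul_nonneg (inv_nonneg.2 hx) (hχ.noiseDensity_nonneg _)

/-- The kernel vanishes off the points reached from `x`. -/
theorem kernelDensity_eq_zero (hχ : IsBump χ a) {x y : ℝ}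
    (h : ∀ u ∈ Icc (-a) a, T x + s x * u ≠ y) : kernelDensity T s χ x y = 0 := by
  rw [kernelDensity]
  by_cases hx : s x = 0
  · simp [hx]
  · rw [hχ.noiseDensity_eq_zero, mul_zero]
    intro hu
    exact h _ hu (by field_simp; ring)

/-- Change of variables `y = T x + s x * u`. Positivity of `s x` is essential: at a noise-free point
`kernelDensity` is zero, whereas `stepOp` evaluates `φ` at `T x`. -/
theorem stepOp_eq_integral_kernelDensity (hχ : IsBump χ a) {x : ℝ} (hx : 0 < s x) :
    stepOp T s χ φ x = ∫ y, kernelDensity T s χ x y * φ y := by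
  rw [stepOp, hχ.integral_noiseLaw]
  rw [← integral_add_left_eq_self (fun y => kernelDensity T s χ x y * φ y) (T x)]
  have h2 := Measure.integral_comp_mul_left
    (fun z => kernelDensity T s χ x (T x + z) * φ (T x + z)) (s x)
  rw [abs_of_pos (inv_pos.2 hx), smul_eq_mul, eq_inv_mul_iff_mul_eq₀ hx.ne'] at h2
  rw [← h2, ← integral_const_mul]
  congr 1 with u
  rw [kernelDensity]
  have : (T x + s x * u - T x) / s x = u := by field_simp; ring
  rw [this]
  field_simp

end StepOp

/-! ### Reachability -/

/-- The points from which `V` can be reached in one step. -/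
def preReach (T s : ℝ → ℝ) (a : ℝ) (V : Set ℝ) : Set ℝ :=
  {y | ∃ u ∈ Icc (-a) a, T y + s y * u ∈ V}

/-- A chain with nondegenerate noise that enters the compact interval `[α, β]` in one step, where
`[α, β]` contains an attracting transitive interval `[d₁, d₂]` of the map. -/
structure IsTrapped (T s χ : ℝ → ℝ) (a s₀ α β d₁ d₂ : ℝ) : Prop where
  bump : IsBump χ a
  a_pos : 0 < a
  continuous_map : Continuous T
  continuous_amp : Continuous s
  amp_min_pos : 0 < s₀
  amp_ge : ∀ x, s₀ ≤ s x
  enters : ∀ x, ∀ u ∈ Icc (-a) a, T x + s x * u ∈ Icc α β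
  bounds_lt : α < β
  lt : d₁ < d₂
  subset : Icc d₁ d₂ ⊆ Icc α β
  forward_invariant : MapsTo T (Icc d₁ d₂) (Icc d₁ d₂)
  transitive : TransitiveOn T (Icc d₁ d₂)
  absorbing : ∀ᵐ x ∂(volume.restrict (Icc α β)),
    ∀ U : Set ℝ, IsOpen U → Icc d₁ d₂ ⊆ U → ∃ k : ℕ, T^[k] x ∈ U

/-- A continuous bump of height at most one on the interval of radius `η` about `z`. -/
def tent (z η y : ℝ) : ℝ := max 0 (min 1 (η - |y - z|))

theorem continuous_tent (z η : ℝ) : Continuous (tent z η) := by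
  unfold tent; fun_prop

theorem tent_nonneg (z η y : ℝ) : 0 ≤ tent z η y := le_max_left _ _

theorem tent_le_one (z η y : ℝ) : tent z η y ≤ 1 :=
  max_le zero_le_one (min_le_left _ _)

theorem abs_tent_le_one (z η y : ℝ) : |tent z η y| ≤ 1 := by
  rw [abs_of_nonneg (tent_nonneg z η y)]; exact tent_le_one z η y

theorem tent_pos {z η y : ℝ} (hy : y ∈ Metric.ball z η) : 0 < tent z η y := by
  rw [Metric.mem_ball, Real.dist_eq] at hy
  exact lt_max_of_lt_right (lt_min one_pos (by linarith))

theorem tent_eq_zero {z η y : ℝ} (hy : y ∉ Metric.ball z η) : tent z η y = 0 := by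
  rw [Metric.mem_ball, Real.dist_eq, not_lt] at hy
  exact max_eq_left ((min_le_right _ _).trans (by linarith))

section Reach

variable {T s χ : ℝ → ℝ} {a : ℝ} {V : Set ℝ}

theorem isOpen_preReach (hT : Continuous T) (hs : Continuous s) (hV : IsOpen V) :
    IsOpen (preReach T s a V) := by
  have : preReach T s a V = ⋃ u ∈ Icc (-a) a, (fun y => T y + s y * u) ⁻¹' V := by
    ext y; simp [preReach]
  rw [this]
  exact isOpen_biUnion fun u _ => hV.preimage (by fun_prop)

theorem isOpen_iterate_preReach (hT : Continuous T) (hs : Continuous s) (hV : IsOpen V) (n : ℕ) :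
    IsOpen ((preReach T s a)^[n] V) := by
  induction n with
  | zero => exact hV
  | succ n ih => rw [Function.iterate_succ_apply']; exact isOpen_preReach hT hs ih

theorem preReach_mono {V W : Set ℝ} (h : V ⊆ W) : preReach T s a V ⊆ preReach T s a W :=
  fun _ ⟨u, hu, hy⟩ => ⟨u, hu, h hy⟩

/-- Being reachable in exactly `n` steps is monotone in `n` only if `V` can be revisited at once.
Monotonicity makes the cover in `exists_minorization` directed, so that one time serves all starting
points. -/
theorem monotone_iterate_preReach (h : V ⊆ preReach T s a V) :
    Monotone fun n => (preReach T s a)^[n] V := by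
  refine monotone_nat_of_le_succ fun n => ?_
  induction n with
  | zero => exact h
  | succ n ih =>
    simp only [Function.iterate_succ_apply'] at ih ⊢
    exact preReach_mono ih

/-- Reachability uses a single noise value per step; since the reach sets are open, nearby values
work too and together have positive probability. -/
theorem iterate_stepOp_pos (hχ : IsBump χ a) (ha : 0 < a) (hT : Continuous T) (hs : Continuous s)
    {φ : ℝ → ℝ} (hφ : Continuous φ) {D : ℝ} (hD : ∀ x, |φ x| ≤ D) (h0 : ∀ x, 0 ≤ φ x)
    (hV : IsOpen V) (hpos : ∀ x ∈ V, 0 < φ x) (n : ℕ) {x : ℝ}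
    (hx : x ∈ (preReach T s a)^[n] V) : 0 < (stepOp T s χ)^[n] φ x := by
  have := hχ.isProbabilityMeasure ha
  induction n generalizing x with
  | zero => exact hpos x hx
  | succ n ih =>
    rw [Function.iterate_succ_apply'] at hx ⊢
    obtain ⟨u, hu, hxu⟩ := hx
    have hc := continuous_iterate_stepOp (χ := χ) hT hs hφ hD n
    have hb := abs_iterate_stepOp_le (T := T) (s := s) (χ := χ) hD n
    have hnn : ∀ y, 0 ≤ (stepOp T s χ)^[n] φ y := fun y =>
      (iterate_stepOp_mem_Icc (M := D) hT.measurable hs.measurable hφ.measurable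
        (fun x => ⟨h0 x, (le_abs_self _).trans (hD x)⟩) n y).1
    rw [stepOp, integral_pos_iff_support_of_nonneg (fun u => hnn _)
      (integrable_shift hc.measurable hb x)]
    have ho : IsOpen ((fun u => T x + s x * u) ⁻¹' (preReach T s a)^[n] V) :=
      (isOpen_iterate_preReach hT hs hV n).preimage (by fun_prop)
    refine (hχ.noiseLaw_pos ha ho ⟨u, hxu, hu⟩).trans_le (measure_mono fun v hv => ?_)
    exact (ih hv).ne'

end Reach

/-! ### Reachability of the transitive interval and Doeblin's condition -/

namespace IsTrapped

variable {T s χ : ℝ → ℝ} {a s₀ α β d₁ d₂ : ℝ} (h : IsTrapped T s χ a s₀ α β d₁ d₂)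

include h

theorem amp_pos (x : ℝ) : 0 < s x := h.amp_min_pos.trans_le (h.amp_ge x)

theorem isProbabilityMeasure : IsProbabilityMeasure (noiseLaw χ) :=
  h.bump.isProbabilityMeasure h.a_pos

theorem map_mem (x : ℝ) : T x ∈ Icc α β := by
  have := h.enters x 0 ⟨by linarith [h.a_pos], h.a_pos.le⟩
  simpa using this

/-- A relatively open subset of the transitive interval is reached from every point. -/
theorem exists_mem_iterate_preReach {V : Set ℝ} (hV : IsOpen V)
    (hne : (V ∩ Icc d₁ d₂).Nonempty) (x : ℝ) : ∃ n, x ∈ (preReach T s a)^[n] V := by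
  set A : Set ℝ := {y | ∃ n, y ∈ (preReach T s a)^[n] V} with hA
  have hAo : IsOpen A := by
    have : A = ⋃ n, (preReach T s a)^[n] V := by ext y; simp [hA]
    rw [this]
    exact isOpen_iUnion fun n => isOpen_iterate_preReach h.continuous_map h.continuous_amp hV n
  have hstep : ∀ y, ∀ u ∈ Icc (-a) a, T y + s y * u ∈ A → y ∈ A := by
    rintro y u hu ⟨n, hn⟩
    refine ⟨n + 1, ?_⟩
    rw [Function.iterate_succ_apply']
    exact ⟨u, hu, hn⟩
  -- Noise `0` at every step follows the deterministic orbit.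
  have horbit : ∀ k y, T^[k] y ∈ A → y ∈ A := by
    intro k
    induction k with
    | zero => exact fun y hy => hy
    | succ k ih =>
      intro y hy
      rw [Function.iterate_succ_apply] at hy
      exact hstep y 0 ⟨by linarith [h.a_pos], h.a_pos.le⟩ (by simpa using ih _ hy)
  -- One noisy step from `y` can hit any point within distance `a * s y` of `T y`.
  have hball : ∀ y v, v ∈ Metric.ball (T y) (a * s y) → v ∈ A → y ∈ A := by
    intro y v hv hvA
    have hs := h.amp_pos y
    rw [Metric.mem_ball, Real.dist_eq, abs_lt] at hv
    refine hstep y ((v - T y) / s y) ⟨?_, ?_⟩ ?_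
    · rw [le_div_iff₀ hs]; linarith
    · rw [div_le_iff₀ hs]; linarith
    · rwa [mul_div_cancel₀ _ hs.ne', add_sub_cancel]
  have hrad : ∀ y, 0 < a * s y := fun y => mul_pos h.a_pos (h.amp_pos y)
  -- Transitivity yields a point `v` near `T w` whose orbit enters `V`: one noisy step goes to `v`,
  -- zero noise does the rest.
  have hX : Icc d₁ d₂ ⊆ A := by
    intro w hw
    obtain ⟨t, v, hvV, hvO, -⟩ := h.transitive V (Metric.ball (T w) (a * s w)) hV
      Metric.isOpen_ball hne ⟨T w, Metric.mem_ball_self (hrad w), h.forward_invariant hw⟩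
    exact hball w v hvO (horbit t v ⟨0, hvV⟩)
  -- `T x` may be an endpoint of `[α, β]`, but the ball about it still meets the interior in a set
  -- of positive measure, hence contains a point with absorbed orbit.
  have hx : (Metric.ball (T x) (a * s x) ∩ Ioo α β).Nonempty := by
    have hcl : T x ∈ closure (Ioo α β) := by
      rw [closure_Ioo h.bounds_lt.ne]; exact h.map_mem x
    exact mem_closure_iff.1 hcl _ Metric.isOpen_ball (Metric.mem_ball_self (hrad x))
  have hpos := (Metric.isOpen_ball.inter isOpen_Ioo).measure_pos volume hx
  by_contra hxA
  refine hpos.ne' (measure_mono_null (fun v hv => ?_)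
    ((ae_restrict_iff' measurableSet_Icc).1 h.absorbing))
  intro hcon
  obtain ⟨k, hk⟩ := hcon ⟨hv.2.1.le, hv.2.2.le⟩ A hAo hX
  exact hxA (hball x v hv.1 (horbit k v hk))

theorem continuous_kernelDensity :
    Continuous fun p : ℝ × ℝ => kernelDensity T s χ p.1 p.2 := by
  have h1 := h.bump.continuous_noiseDensity
  have h2 := h.continuous_map
  have h3 := h.continuous_amp
  have h4 : ∀ p : ℝ × ℝ, s p.1 ≠ 0 := fun p => (h.amp_pos p.1).ne'
  unfold kernelDensity
  refine Continuous.mul (Continuous.inv₀ (by fun_prop) h4) (h1.comp ?_)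
  exact Continuous.div (by fun_prop) (by fun_prop) h4

theorem exists_kernelDensity_le : ∃ K, 0 < K ∧ ∀ x y, |kernelDensity T s χ x y| ≤ K := by
  obtain ⟨K, hK, hle⟩ := h.bump.exists_noiseDensity_le
  refine ⟨s₀⁻¹ * K, mul_pos (inv_pos.2 h.amp_min_pos) hK, fun x y => ?_⟩
  rw [abs_of_nonneg (kernelDensity_nonneg h.bump (h.amp_pos x).le y)]
  exact mul_le_mul (inv_anti₀ h.amp_min_pos (h.amp_ge x)) (hle _) (h.bump.noiseDensity_nonneg _)
    (inv_pos.2 h.amp_min_pos).le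

theorem exists_lipschitz_kernelDensity :
    ∃ K : NNReal, ∀ x y z,
      |kernelDensity T s χ x y - kernelDensity T s χ x z| ≤ K * |y - z| := by
  obtain ⟨L, hL⟩ := h.bump.exists_lipschitz_noiseDensity
  have h0 := inv_pos.2 h.amp_min_pos
  -- One factor `s₀⁻¹` bounds the prefactor of the kernel, the other the rescaling of its argument.
  refine ⟨Real.toNNReal (s₀⁻¹ * (L * s₀⁻¹)), fun x y z => ?_⟩
  have hs := h.amp_pos x
  have hinv : (s x)⁻¹ ≤ s₀⁻¹ := inv_anti₀ h.amp_min_pos (h.amp_ge x)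
  have h1 := hL.dist_le_mul ((y - T x) / s x) ((z - T x) / s x)
  rw [Real.dist_eq, Real.dist_eq, ← sub_div, sub_sub_sub_cancel_right, abs_div, abs_of_pos hs] at h1
  rw [Real.coe_toNNReal _ (by positivity)]
  rw [kernelDensity, kernelDensity, ← mul_sub, abs_mul, abs_of_pos (inv_pos.2 hs)]
  calc _ ≤ s₀⁻¹ * (L * (|y - z| * s₀⁻¹)) := by gcongr; exact h1.trans (by rw [div_eq_mul_inv]; gcongr)
    _ = _ := by ring

/-- Doeblin's minorization condition. -/
theorem exists_minorization : ∃ (N : ℕ) (δ : ℝ) (W : Set ℝ), 0 < δ ∧ MeasurableSet W ∧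
    0 < volume.real W ∧ ∀ (φ : ℝ → ℝ) (D : ℝ), Measurable φ → (∀ x, φ x ∈ Icc 0 D) →
      ∀ x, δ * ∫ y in W, φ y ≤ (stepOp T s χ)^[N] φ x := by
  have hprob := h.isProbabilityMeasure
  have hTm := h.continuous_map.measurable
  have hsm := h.continuous_amp.measurable
  -- Near a fixed point `z` a small noise leads back to exactly `z`, so a small ball about `z` lies
  -- in its own one-step reach.
  obtain ⟨z, hz, hfix⟩ := exists_mem_Icc_isFixedPt_of_mapsTo h.continuous_map.continuousOn h.lt.le
    h.forward_invariant
  -- `χ 0` may be zero, so the kernel is bounded below near `(z, w)` for some `w` hit with positive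
  -- density, not near `(z, z)`.
  obtain ⟨u, -, hu⟩ := h.bump.exists_pos isOpen_univ
    ⟨0, mem_univ _, by constructor <;> linarith [h.a_pos]⟩
  set w := T z + s z * u
  have hp : 0 < kernelDensity T s χ z w := by
    refine mul_pos (inv_pos.2 (h.amp_pos z)) (h.bump.noiseDensity_pos h.a_pos ?_)
    have : (w - T z) / s z = u := by
      rw [add_sub_cancel_left, mul_div_cancel_left₀ _ (h.amp_pos z).ne']
    rwa [this]
  set κ := kernelDensity T s χ z w / 2
  have hκ : 0 < κ := half_pos hp
  obtain ⟨η₁, hη₁, hball₁⟩ := Metric.isOpen_iff.1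
    (isOpen_lt continuous_const h.continuous_kernelDensity) (z, w) (half_lt_self hp)
  obtain ⟨η₂, hη₂, hball₂⟩ := Metric.isOpen_iff.1
    (isOpen_lt (f := fun y => |z - T y|) (g := fun y => a * s y)
      (by have := h.continuous_map; fun_prop) (by have := h.continuous_amp; fun_prop)) z
      (by simpa [hfix.eq] using mul_pos h.a_pos (h.amp_pos z))
  set η := min η₁ η₂
  have hη : 0 < η := lt_min hη₁ hη₂
  set B := Metric.ball z η
  have hBpre : B ⊆ preReach T s a B := by
    intro y hy
    have hs := h.amp_pos y
    have h2 : |z - T y| < a * s y := hball₂ (Metric.ball_subset_ball (min_le_right _ _) hy)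
    rw [abs_lt] at h2
    refine ⟨(z - T y) / s y, ⟨?_, ?_⟩, ?_⟩
    · rw [le_div_iff₀ hs]; linarith
    · rw [div_le_iff₀ hs]; linarith
    · rw [mul_div_cancel₀ _ hs.ne', add_sub_cancel]; exact Metric.mem_ball_self hη
  obtain ⟨N, hN⟩ := (isCompact_Icc (a := α) (b := β)).elim_directed_cover
    (fun n => (preReach T s a)^[n] B)
    (isOpen_iterate_preReach h.continuous_map h.continuous_amp Metric.isOpen_ball)
    (fun x _ => mem_iUnion.2 (h.exists_mem_iterate_preReach Metric.isOpen_ball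
      ⟨z, Metric.mem_ball_self hη, hz⟩ x))
    (monotone_iterate_preReach hBpre).directed_le
  set b := tent z η
  have hbc : Continuous b := continuous_tent z η
  obtain ⟨x₀, hx₀, hmin⟩ := (isCompact_Icc (a := α) (b := β)).exists_isMinOn
    (nonempty_Icc.2 h.bounds_lt.le) (continuous_iterate_stepOp (χ := χ) h.continuous_map
      h.continuous_amp hbc (abs_tent_le_one z η) N).continuousOn
  set δ := (stepOp T s χ)^[N] b x₀
  have hδ : 0 < δ := iterate_stepOp_pos h.bump h.a_pos h.continuous_map h.continuous_amp hbc
    (abs_tent_le_one z η) (tent_nonneg z η) Metric.isOpen_ball (fun y hy => tent_pos hy) N (hN hx₀)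
  have hlow : ∀ x, δ ≤ (stepOp T s χ)^[N + 1] b x := by
    intro x
    rw [Function.iterate_succ_apply']
    have hi := integrable_shift (T := T) (s := s) (χ := χ)
      (measurable_iterate_stepOp hTm hsm hbc.measurable N)
      (abs_iterate_stepOp_le (T := T) (s := s) (χ := χ) (abs_tent_le_one z η) N) x
    have := integral_mono_ae (integrable_const δ) hi
      (h.bump.ae_mem.mono fun v hv => hmin (h.enters x v hv))
    simpa [stepOp] using this
  -- One step to enter `[α, β]`, `N` steps to reach the ball about `z`, and a last step whose
  -- density is at least `κ` on the ball about `w`.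
  refine ⟨N + 1 + 1, κ * δ, Metric.ball w η, mul_pos hκ hδ, measurableSet_ball, ?_, ?_⟩
  · rw [Real.volume_real_ball hη.le]; positivity
  intro φ D hφ hD x
  have hDabs : ∀ y, |φ y| ≤ D := fun y => by rw [abs_of_nonneg (hD y).1]; exact (hD y).2
  set I := ∫ y in Metric.ball w η, φ y
  have hI : 0 ≤ I := integral_nonneg fun y => (hD y).1
  -- The summand `0` only matches the shape of `iterate_stepOp_affine`.
  have hone : ∀ y, κ * I * b y + 0 ≤ stepOp T s χ φ y := by
    intro y
    by_cases hy : y ∈ B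
    · rw [stepOp_eq_integral_kernelDensity h.bump (h.amp_pos y)]
      obtain ⟨K, hK, hle⟩ := h.exists_kernelDensity_le
      have hkm : Measurable (kernelDensity T s χ y) :=
        (measurable_kernelDensity h.bump hTm hsm).comp measurable_prodMk_left
      have hk0 := kernelDensity_nonneg (T := T) h.bump (h.amp_pos y).le
      have hint : Integrable fun v => kernelDensity T s χ y v * φ v := by
        have hon : IntegrableOn (fun v => kernelDensity T s χ y v * φ v) (Icc α β) :=
          Integrable.of_bound (hkm.mul hφ).aestronglyMeasurable (K * D)
            (ae_of_all _ fun v => by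
              rw [Real.norm_eq_abs, abs_mul]
              exact mul_le_mul (hle y v) (hDabs v) (abs_nonneg _) hK.le)
        refine (integrableOn_iff_integrable_of_support_subset fun v hv => ?_).1 hon
        by_contra hvJ
        refine hv ?_
        simp only
        rw [kernelDensity_eq_zero h.bump, zero_mul]
        rintro u hu rfl
        exact hvJ (h.enters y u hu)
      calc κ * I * b y + 0 ≤ κ * I * 1 := by
            rw [add_zero]
            exact mul_le_mul_of_nonneg_left (tent_le_one _ _ _) (mul_nonneg hκ.le hI)
        _ = ∫ v in Metric.ball w η, κ * φ v := by rw [mul_one, integral_const_mul]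
        _ ≤ ∫ v in Metric.ball w η, kernelDensity T s χ y v * φ v := by
            refine setIntegral_mono_on ?_ hint.integrableOn measurableSet_ball fun v hv => ?_
            · refine Integrable.const_mul ?_ _
              have : IsFiniteMeasure (volume.restrict (Metric.ball w η)) :=
                ⟨by rw [Measure.restrict_apply_univ]; exact measure_ball_lt_top⟩
              exact integrable_of_measurable_of_abs_le hφ hDabs
            · refine mul_le_mul_of_nonneg_right (le_of_lt ?_) (hD v).1
              refine hball₁ (a := (y, v)) ?_
              rw [← ball_prod_same]
              exact ⟨Metric.ball_subset_ball (min_le_left _ _) hy,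
                Metric.ball_subset_ball (min_le_left _ _) hv⟩
        _ ≤ ∫ v, kernelDensity T s χ y v * φ v :=
            setIntegral_le_integral hint (ae_of_all _ fun v => mul_nonneg (hk0 v) (hD v).1)
    · rw [show b y = 0 from tent_eq_zero hy, mul_zero, add_zero]
      exact integral_nonneg fun u => (hD _).1
  have hkb : ∀ y, |κ * I * b y + 0| ≤ κ * I * 1 := fun y => by
    rw [add_zero, abs_mul, abs_of_nonneg (mul_nonneg hκ.le hI)]
    exact mul_le_mul_of_nonneg_left (abs_tent_le_one _ _ _) (mul_nonneg hκ.le hI)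
  calc κ * δ * I = κ * I * δ + 0 := by ring
    _ ≤ κ * I * (stepOp T s χ)^[N + 1] b x + 0 := by
        gcongr; exact hlow x
    _ = (stepOp T s χ)^[N + 1] (fun y => κ * I * b y + 0) x :=
        (iterate_stepOp_affine hTm hsm hbc.measurable (abs_tent_le_one z η) _ _ _ _).symm
    _ ≤ (stepOp T s χ)^[N + 1] (stepOp T s χ φ) x :=
        iterate_stepOp_mono hTm hsm (by fun_prop) (measurable_stepOp hTm hsm hφ) hkb
          (abs_stepOp_le hDabs) hone _ _
    _ = (stepOp T s χ)^[N + 1 + 1] φ x := by rw [← Function.iterate_succ_apply]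

end IsTrapped

/-! ### Exponential convergence and the stationary density -/

namespace IsTrapped

variable {T s χ : ℝ → ℝ} {a s₀ α β d₁ d₂ : ℝ} (h : IsTrapped T s χ a s₀ α β d₁ d₂)

include h

/-- Some iterate contracts the oscillation of bounded functions. -/
theorem exists_oscillation_contraction : ∃ (N : ℕ) (q : ℝ), 0 < q ∧ q < 1 ∧
    ∀ (φ : ℝ → ℝ) (m D : ℝ), Measurable φ → (∀ x, φ x ∈ Icc m (m + D)) →
      ∃ m', ∀ x, (stepOp T s χ)^[N] φ x ∈ Icc m' (m' + q * D) := by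
  have hprob := h.isProbabilityMeasure
  have hTm := h.continuous_map.measurable
  have hsm := h.continuous_amp.measurable
  obtain ⟨N, δ, W, hδ, hWm, hW, hmin⟩ := h.exists_minorization
  have hfin : IsFiniteMeasure (volume.restrict W) := by
    refine ⟨?_⟩
    rw [Measure.restrict_apply_univ, lt_top_iff_ne_top]
    intro htop
    simp [Measure.real, htop] at hW
  set θ := δ * volume.real W
  have hθ : 0 < θ := mul_pos hδ hW
  have hθ1 : θ ≤ 1 := by
    have := hmin (fun _ => 1) 1 measurable_const (fun _ => ⟨zero_le_one, le_rfl⟩) 0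
    rw [iterate_stepOp_const] at this
    simpa [θ] using this
  -- The argument gives the factor `1 - θ`, which may be zero; `1 - θ / 2` is strictly positive.
  refine ⟨N, 1 - θ / 2, by linarith, by linarith, fun φ m D hφ hm => ?_⟩
  have hD : 0 ≤ D := by linarith [(hm 0).1, (hm 0).2]
  have hb : ∀ x, |φ x| ≤ max |m| |m + D| := fun x => abs_le_max_abs_abs (hm x).1 (hm x).2
  have hint : Integrable φ (volume.restrict W) := integrable_of_measurable_of_abs_le hφ hb
  set I := ∫ y in W, φ y
  -- Minorizing both `φ - m` and `m + D - φ` raises the lower bound and lowers the upper one;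
  -- together the two gains amount to `θ * D`.
  have h1 : ∀ x, δ * (I - volume.real W * m) ≤ (stepOp T s χ)^[N] φ x - m := by
    intro x
    have := hmin (fun y => 1 * φ y + -m) D (by fun_prop)
      (fun y => ⟨by linarith [(hm y).1], by linarith [(hm y).2]⟩) x
    rw [iterate_stepOp_affine hTm hsm hφ hb, integral_add (by simpa using hint)
      (integrable_const _)] at this
    simp only [one_mul, integral_const, measureReal_restrict_apply_univ, smul_eq_mul] at this
    linarith
  have h2 : ∀ x, δ * (volume.real W * (m + D) - I) ≤ m + D - (stepOp T s χ)^[N] φ x := by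
    intro x
    have := hmin (fun y => -1 * φ y + (m + D)) D (by fun_prop)
      (fun y => ⟨by linarith [(hm y).2], by linarith [(hm y).1]⟩) x
    rw [iterate_stepOp_affine hTm hsm hφ hb, integral_add (by simpa using hint.neg)
      (integrable_const _), integral_const_mul] at this
    simp only [integral_const, measureReal_restrict_apply_univ, smul_eq_mul] at this
    linarith
  refine ⟨m + δ * (I - volume.real W * m), fun x => ⟨by linarith [h1 x], ?_⟩⟩
  have h3 : (stepOp T s χ)^[N] φ x ≤ m + δ * (I - volume.real W * m) + (1 - θ) * D := by
    have := h2 x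
    simp only [θ]
    linarith
  have : 0 ≤ θ / 2 * D := by positivity
  linarith

/-- The oscillation of the iterates decays exponentially. -/
theorem exists_oscillation_decay : ∃ r C : ℝ, 0 < r ∧ r < 1 ∧ 0 < C ∧
    ∀ (φ : ℝ → ℝ) (m D : ℝ), Measurable φ → (∀ x, φ x ∈ Icc m (m + D)) →
      ∀ t : ℕ, ∃ m', ∀ x, (stepOp T s χ)^[t] φ x ∈ Icc m' (m' + C * r ^ t * D) := by
  have hprob := h.isProbabilityMeasure
  have hTm := h.continuous_map.measurable
  have hsm := h.continuous_amp.measurable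
  obtain ⟨N, q, hq, hq1, hcon⟩ := h.exists_oscillation_contraction
  have hiter : ∀ (k : ℕ) (φ : ℝ → ℝ) (m D : ℝ), Measurable φ → (∀ x, φ x ∈ Icc m (m + D)) →
      ∃ m', ∀ x, (stepOp T s χ)^[N * k] φ x ∈ Icc m' (m' + q ^ k * D) := by
    intro k
    induction k with
    | zero => intro φ m D _ hm; exact ⟨m, by simpa using hm⟩
    | succ k ih =>
      intro φ m D hφ hm
      obtain ⟨m', hm'⟩ := ih φ m D hφ hm
      obtain ⟨m'', hm''⟩ := hcon _ m' _ (measurable_iterate_stepOp hTm hsm hφ _) hm'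
      refine ⟨m'', fun x => ?_⟩
      have := hm'' x
      rwa [← Function.iterate_add_apply, ← mul_assoc, ← pow_succ', add_comm N, ← Nat.mul_succ]
        at this
  -- For `N = 0` the iterate is the identity, which does not contract the oscillation of a ramp from
  -- `0` to `1`.
  have hN : N ≠ 0 := by
    rintro rfl
    obtain ⟨m', hm'⟩ := hcon (fun x => max 0 (min x 1)) 0 1 (by fun_prop)
      (fun x => ⟨le_max_left _ _, max_le (by norm_num) (by simp)⟩)
    have h0 := (hm' 0).1
    have h1 := (hm' 1).2
    simp at h0 h1
    linarith
  -- `r` is the rate per single step; the constant `(r ^ N)⁻¹` pays for the incomplete last block of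
  -- `t % N` steps.
  set r := q ^ ((N : ℝ)⁻¹)
  have hr : 0 < r := Real.rpow_pos_of_pos hq _
  have hr1 : r < 1 := Real.rpow_lt_one hq.le hq1 (by positivity)
  have hrN : r ^ N = q := Real.rpow_inv_natCast_pow hq.le hN
  refine ⟨r, (r ^ N)⁻¹, hr, hr1, by positivity, fun φ m D hφ hm t => ?_⟩
  have hD : 0 ≤ D := by linarith [(hm 0).1, (hm 0).2]
  obtain ⟨m', hm'⟩ := hiter (t / N) φ m D hφ hm
  refine ⟨m', fun x => ?_⟩
  have h1 := iterate_stepOp_mem_Icc (χ := χ) hTm hsm (measurable_iterate_stepOp hTm hsm hφ _) hm'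
    (t % N) x
  rw [← Function.iterate_add_apply, Nat.mod_add_div] at h1
  refine ⟨h1.1, h1.2.trans ?_⟩
  have h2 : q ^ (t / N) ≤ (r ^ N)⁻¹ * r ^ t := by
    rw [← hrN, ← pow_mul, le_inv_mul_iff₀ (by positivity), ← pow_add]
    refine pow_le_pow_of_le_one hr.le hr1.le ?_
    have := Nat.mod_add_div t N
    have := Nat.mod_lt t (Nat.pos_of_ne_zero hN)
    omega
  gcongr

/-- The iterates of a bounded function converge uniformly to a constant. -/
theorem exists_limit : ∃ r C : ℝ, 0 < r ∧ r < 1 ∧ 0 < C ∧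
    ∀ (φ : ℝ → ℝ) (D : ℝ), Measurable φ → (∀ x, |φ x| ≤ D) →
      ∃ l, ∀ (t : ℕ) (x : ℝ), |(stepOp T s χ)^[t] φ x - l| ≤ C * r ^ t * D := by
  have hprob := h.isProbabilityMeasure
  have hTm := h.continuous_map.measurable
  have hsm := h.continuous_amp.measurable
  obtain ⟨r, C, hr, hr1, hC, hosc⟩ := h.exists_oscillation_decay
  refine ⟨r, 2 * C, hr, hr1, by positivity, fun φ D hφ hD => ?_⟩
  -- The band containing `Q^t φ` also contains all later iterates, so values at different times and
  -- points are comparable.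
  have hclose : ∀ t t' x x', t ≤ t' →
      |(stepOp T s χ)^[t] φ x - (stepOp T s χ)^[t'] φ x'| ≤ 2 * C * r ^ t * D := by
    intro t t' x x' htt
    obtain ⟨m, hm⟩ := hosc φ (-D) (2 * D) hφ
      (fun y => ⟨(abs_le.1 (hD y)).1, by linarith [(abs_le.1 (hD y)).2]⟩) t
    have h1 := iterate_stepOp_mem_Icc (χ := χ) hTm hsm (measurable_iterate_stepOp hTm hsm hφ t) hm
      (t' - t) x'
    rw [← Function.iterate_add_apply, Nat.sub_add_cancel htt] at h1
    have h2 := hm x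
    rw [abs_le]
    constructor <;> linarith [h1.1, h1.2, h2.1, h2.2]
  have hlim0 : Tendsto (fun t : ℕ => 2 * C * r ^ t * D) atTop (𝓝 0) := by
    have := ((tendsto_pow_atTop_nhds_zero_of_lt_one hr.le hr1).const_mul (2 * C)).mul_const D
    simpa using this
  have hcau : CauchySeq fun t => (stepOp T s χ)^[t] φ 0 := by
    have hcl2 : Tendsto (fun t : ℕ => 2 * (2 * C * r ^ t * D)) atTop (𝓝 0) := by
      simpa using hlim0.const_mul 2
    refine cauchySeq_of_le_tendsto_0 _ (fun n k t hn hk => ?_) hcl2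
    have h1 := hclose t n 0 0 hn
    have h2 := hclose t k 0 0 hk
    rw [Real.dist_eq]
    rw [abs_le] at *
    constructor <;> linarith [h1.1, h1.2, h2.1, h2.2]
  obtain ⟨l, hl⟩ := cauchySeq_tendsto_of_complete hcau
  refine ⟨l, fun t x => ?_⟩
  refine le_of_tendsto ((tendsto_const_nhds.sub hl).abs) ?_
  filter_upwards [eventually_ge_atTop t] with t' ht' using hclose t t' x 0 ht'

theorem measurable_iterate_kernelDensity (t : ℕ) :
    Measurable fun p : ℝ × ℝ =>
      (stepOp T s χ)^[t] (fun x => kernelDensity T s χ x p.2) p.1 := by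
  have hprob := h.isProbabilityMeasure
  have hTm := h.continuous_map.measurable
  have hsm := h.continuous_amp.measurable
  induction t with
  | zero => exact measurable_kernelDensity h.bump hTm hsm
  | succ t ih =>
    simp only [Function.iterate_succ_apply', stepOp]
    have hm : Measurable fun q : (ℝ × ℝ) × ℝ => (T q.1.1 + s q.1.1 * q.2, q.1.2) := by fun_prop
    exact (ih.comp hm).stronglyMeasurable.integral_prod_right'.measurable

/-- The iterated kernel is a density of the law of the chain. -/
theorem setIntegral_mul_iterate_kernelDensity {φ : ℝ → ℝ} {D : ℝ} (hφ : Measurable φ)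
    (hD : ∀ x, |φ x| ≤ D) (t : ℕ) (x : ℝ) :
    ∫ y in Icc α β, φ y * (stepOp T s χ)^[t] (fun x => kernelDensity T s χ x y) x =
      (stepOp T s χ)^[t + 1] φ x := by
  have hprob := h.isProbabilityMeasure
  obtain ⟨K, hK, hle⟩ := h.exists_kernelDensity_le
  induction t generalizing x with
  | zero =>
    rw [Function.iterate_zero, zero_add, Function.iterate_one,
      stepOp_eq_integral_kernelDensity h.bump (h.amp_pos x)]
    rw [setIntegral_eq_integral_of_forall_compl_eq_zero]
    · simp only [id, mul_comm]
    · intro y hy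
      simp only [id]
      rw [kernelDensity_eq_zero h.bump, mul_zero]
      rintro u hu rfl
      exact hy (h.enters x u hu)
  | succ t ih =>
    rw [Function.iterate_succ_apply' _ (t + 1)]
    rw [stepOp]
    simp only [← ih, Function.iterate_succ_apply' (stepOp T s χ) t]
    simp only [stepOp, ← integral_const_mul]
    refine integral_integral_swap (Integrable.of_bound
      (Measurable.aestronglyMeasurable ?_) (D * K) (ae_of_all _ fun p => ?_))
    · have hm : Measurable fun p : ℝ × ℝ => (T x + s x * p.2, p.1) := by fun_prop
      exact (hφ.comp measurable_fst).mul ((h.measurable_iterate_kernelDensity t).comp hm)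
    · simp only [Function.uncurry, norm_mul, Real.norm_eq_abs]
      exact mul_le_mul (hD _) (abs_iterate_stepOp_le (fun x => hle x p.1) t _) (abs_nonneg _)
        ((abs_nonneg _).trans (hD 0))

/-- The chain has a Lipschitz stationary density, and converges to it exponentially. -/
theorem exists_density : ∃ ρ : ℝ → ℝ, (∃ K, LipschitzWith K ρ) ∧ (∀ y, 0 ≤ ρ y) ∧
    (∀ y ∉ Icc α β, ρ y = 0) ∧ ∫ y, ρ y = 1 ∧
    (∀ (φ : ℝ → ℝ) (D : ℝ), Measurable φ → (∀ x, |φ x| ≤ D) →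
      ∫ y, stepOp T s χ φ y * ρ y = ∫ y, φ y * ρ y) ∧
    ∃ r C : ℝ, 0 < r ∧ r < 1 ∧ 0 < C ∧
      ∀ (φ : ℝ → ℝ) (D : ℝ), Measurable φ → (∀ x, |φ x| ≤ D) → ∀ (t : ℕ) (x : ℝ),
        |(stepOp T s χ)^[t] φ x - ∫ y, φ y * ρ y| ≤ C * r ^ t * D := by
  have hprob := h.isProbabilityMeasure
  have hTm := h.continuous_map.measurable
  have hsm := h.continuous_amp.measurable
  obtain ⟨r, C, hr, hr1, hC, hlim⟩ := h.exists_limit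
  obtain ⟨K, hK, hle⟩ := h.exists_kernelDensity_le
  obtain ⟨L, hL⟩ := h.exists_lipschitz_kernelDensity
  have hkm : ∀ y, Measurable fun x => kernelDensity T s χ x y := fun y =>
    (measurable_kernelDensity h.bump hTm hsm).comp measurable_prodMk_right
  have htend : ∀ (φ : ℝ → ℝ) (D l : ℝ),
      (∀ (t : ℕ) (x : ℝ), |(stepOp T s χ)^[t] φ x - l| ≤ C * r ^ t * D) →
      Tendsto (fun t => (stepOp T s χ)^[t] φ 0) atTop (𝓝 l) := by
    intro φ D l hl
    have h0 : Tendsto (fun t : ℕ => C * r ^ t * D) atTop (𝓝 0) := by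
      simpa using ((tendsto_pow_atTop_nhds_zero_of_lt_one hr.le hr1).const_mul C).mul_const D
    exact tendsto_iff_norm_sub_tendsto_zero.2 (squeeze_zero (fun _ => norm_nonneg _)
      (fun t => hl t 0) h0)
  -- `Q^t p(·, y)` is the density at `y` after `t + 1` steps; its constant limit is the candidate
  -- for the stationary density.
  choose ρ hρ using fun y => hlim _ K (hkm y) fun x => hle x y
  have hρt := fun y => htend _ K _ (hρ y)
  have hnn : ∀ y, 0 ≤ ρ y := fun y => ge_of_tendsto' (hρt y) fun t =>
    (iterate_stepOp_mem_Icc hTm hsm (hkm y) (fun x => ⟨kernelDensity_nonneg h.bump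
      (h.amp_pos x).le y, (le_abs_self _).trans (hle x y)⟩) t 0).1
  have hzero : ∀ y ∉ Icc α β, ρ y = 0 := by
    intro y hy
    have hk : (fun x => kernelDensity T s χ x y) = fun _ => 0 := by
      funext x
      refine kernelDensity_eq_zero h.bump ?_
      rintro u hu rfl
      exact hy (h.enters x u hu)
    have := hρt y
    rw [hk] at this
    simp only [iterate_stepOp_const] at this
    exact (tendsto_nhds_unique this tendsto_const_nhds)
  -- The bound `p(x, y) ≤ p(x, z) + L|y - z|` is uniform in `x`; it survives the positive operator
  -- `Q^t` and the limit.
  have hlip : LipschitzWith L ρ := by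
    refine LipschitzWith.of_le_add_mul L fun y z => ?_
    rw [Real.dist_eq]
    refine le_of_tendsto_of_tendsto' (hρt y) ((hρt z).add_const (L * |y - z|)) fun t => ?_
    have h1 := iterate_stepOp_mono (T := T) (s := s) (χ := χ) hTm hsm (hkm y)
      (ψ := fun x => 1 * kernelDensity T s χ x z + L * |y - z|)
      (by have := hkm z; fun_prop) (fun x => hle x y) (E := K + L * |y - z|)
      (fun x => by
        have hx := abs_le.1 (hle x z)
        have hp : 0 ≤ (L : ℝ) * |y - z| := by positivity
        rw [abs_le]
        constructor <;> linarith [hx.1, hx.2])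
      (fun x => by linarith [(abs_le.1 (hL x y z)).2]) t 0
    rwa [iterate_stepOp_affine hTm hsm (hkm z) (fun x => hle x z), one_mul] at h1
  -- Integrating the convergence of densities against `φ` identifies the abstract limit constant
  -- with `∫ φ ρ`.
  have hint : ∀ (φ : ℝ → ℝ) (D : ℝ), Measurable φ → (∀ x, |φ x| ≤ D) →
      Tendsto (fun t => (stepOp T s χ)^[t] φ 0) atTop (𝓝 (∫ y, φ y * ρ y)) := by
    intro φ D hφ hD
    rw [← tendsto_add_atTop_iff_nat 1]
    rw [← setIntegral_eq_integral_of_forall_compl_eq_zero (s := Icc α β)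
      (fun y hy => by rw [hzero y hy, mul_zero])]
    simp only [← h.setIntegral_mul_iterate_kernelDensity hφ hD]
    refine tendsto_integral_of_dominated_convergence (fun _ => D * K) (fun t => ?_)
      (integrable_const _) (fun t => ae_of_all _ fun y => ?_)
      (ae_of_all _ fun y => (hρt y).const_mul _)
    · exact (hφ.mul ((h.measurable_iterate_kernelDensity t).comp
        measurable_prodMk_left)).aestronglyMeasurable
    · rw [norm_mul, Real.norm_eq_abs, Real.norm_eq_abs]
      exact mul_le_mul (hD _) (abs_iterate_stepOp_le (fun x => hle x y) t _) (abs_nonneg _)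
        ((abs_nonneg _).trans (hD 0))
  refine ⟨ρ, ⟨L, hlip⟩, hnn, hzero, ?_, fun φ D hφ hD => ?_, r, C, hr, hr1, hC,
    fun φ D hφ hD t x => ?_⟩
  · have := hint (fun _ => 1) 1 measurable_const (by simp)
    simp only [iterate_stepOp_const, one_mul] at this
    exact (tendsto_nhds_unique this tendsto_const_nhds)
  -- Stationarity: the iterates of `Q φ` are those of `φ` shifted by one, so both have the same
  -- limit.
  · refine tendsto_nhds_unique (hint _ D (measurable_stepOp hTm hsm hφ) (abs_stepOp_le hD)) ?_
    simp only [← Function.iterate_succ_apply]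
    exact (tendsto_add_atTop_iff_nat 1).2 (hint φ D hφ hD)
  · obtain ⟨l, hl⟩ := hlim φ D hφ hD
    rw [tendsto_nhds_unique (hint φ D hφ hD) (htend φ D l hl)]
    exact hl t x

/-- A stationary density charges every neighbourhood of every point of the transitive interval. -/
theorem withDensity_pos {ρ : ℝ → ℝ} (hρ : Continuous ρ) (hnn : ∀ y, 0 ≤ ρ y)
    (hone : ∫ y, ρ y = 1)
    (hstat : ∀ (φ : ℝ → ℝ) (D : ℝ), Measurable φ → (∀ x, |φ x| ≤ D) →
      ∫ y, stepOp T s χ φ y * ρ y = ∫ y, φ y * ρ y)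
    {V : Set ℝ} (hV : IsOpen V) (hne : (V ∩ Icc d₁ d₂).Nonempty) :
    0 < volume.withDensity (fun y => ENNReal.ofReal (ρ y)) V := by
  have hprob := h.isProbabilityMeasure
  have hTm := h.continuous_map.measurable
  have hsm := h.continuous_amp.measurable
  have hρi : Integrable ρ := by
    by_contra hn
    rw [integral_undef hn] at hone
    exact zero_ne_one hone
  obtain ⟨z, hzV, hz⟩ := hne
  obtain ⟨η, hη, hball⟩ := Metric.isOpen_iff.1 hV z hzV
  set b := tent z η
  have hbc : Continuous b := continuous_tent z η
  have hb1 : ∀ y, |b y| ≤ 1 := abs_tent_le_one z η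
  rw [pos_iff_ne_zero]
  intro h0
  have hb0 : ∫ y, b y * ρ y = 0 := by
    rw [withDensity_apply _ hV.measurableSet,
      lintegral_eq_zero_iff hρ.measurable.ennreal_ofReal] at h0
    rw [integral_eq_zero_of_ae]
    filter_upwards [(ae_restrict_iff' hV.measurableSet).1 h0] with y hy
    by_cases hyV : y ∈ V
    · have := hy hyV
      simp only [Pi.zero_apply, ENNReal.ofReal_eq_zero] at this
      simp [le_antisymm this (hnn y)]
    · simp [b, tent_eq_zero fun hyB => hyV (hball hyB)]
  -- If `V` were null, stationarity would make every `Q^n b` vanish almost everywhere for the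
  -- measure, although each point has some `n` with `Q^n b > 0`.
  have hiter : ∀ n, ∫ y, (stepOp T s χ)^[n] b y * ρ y = 0 := by
    intro n
    induction n with
    | zero => exact hb0
    | succ n ih =>
      rw [Function.iterate_succ_apply', hstat _ 1 (measurable_iterate_stepOp hTm hsm hbc.measurable n)
        (abs_iterate_stepOp_le hb1 n), ih]
  have hae : ∀ᵐ y, ∀ n, (stepOp T s χ)^[n] b y * ρ y = 0 := by
    rw [ae_all_iff]
    intro n
    refine (integral_eq_zero_iff_of_nonneg (fun y => mul_nonneg ?_ (hnn y)) ?_).1 (hiter n)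
    · exact (iterate_stepOp_mem_Icc hTm hsm hbc.measurable
        (fun y => ⟨tent_nonneg z η y, tent_le_one z η y⟩) n y).1
    · exact hρi.bdd_mul (c := 1)
        (measurable_iterate_stepOp hTm hsm hbc.measurable n).aestronglyMeasurable
        (ae_of_all _ (abs_iterate_stepOp_le hb1 n))
  have hρ0 : ∫ y, ρ y = 0 := by
    rw [integral_eq_zero_of_ae]
    filter_upwards [hae] with y hy
    obtain ⟨n, hn⟩ := h.exists_mem_iterate_preReach Metric.isOpen_ball
      ⟨z, Metric.mem_ball_self hη, hz⟩ y
    have hpos := iterate_stepOp_pos h.bump h.a_pos h.continuous_map h.continuous_amp hbc hb1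
      (tent_nonneg z η) Metric.isOpen_ball (fun y hy => tent_pos hy) n hn
    exact (mul_eq_zero.1 (hy n)).resolve_left hpos.ne'
  rw [hone] at hρ0
  exact one_ne_zero hρ0

end IsTrapped

/-! ### Extension from an interval by constants -/

/-- The function that agrees with `f` on `[l, b]` and is constant to the left and the right. -/
def clampExtend (l b : ℝ) (f : ℝ → ℝ) (x : ℝ) : ℝ := f (max l (min x b))

theorem clamp_mem {l b : ℝ} (hlb : l ≤ b) (x : ℝ) : max l (min x b) ∈ Icc l b :=
  ⟨le_max_left _ _, max_le hlb (min_le_right _ _)⟩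

theorem clampExtend_eqOn (l b : ℝ) (f : ℝ → ℝ) : EqOn f (clampExtend l b f) (Icc l b) := by
  intro x hx
  rw [clampExtend, min_eq_left hx.2, max_eq_right hx.1]

theorem continuous_clampExtend {l b : ℝ} (hlb : l ≤ b) {f : ℝ → ℝ}
    (hf : ContinuousOn f (Icc l b)) : Continuous (clampExtend l b f) :=
  hf.comp_continuous (by fun_prop) (clamp_mem hlb)

/-! ### Functions of bounded variation -/

/-- By Jordan decomposition `g` is a difference of monotone functions, which stay monotone when
extended by constants. -/
theorem measurable_indicator_of_boundedVariationOn {g : ℝ → ℝ} {l b : ℝ}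
    (hg : BoundedVariationOn g (Icc l b)) : Measurable ((Icc l b).indicator g) := by
  by_cases hlb : l ≤ b
  · obtain ⟨p, q, hp, hq, rfl⟩ :=
      hg.locallyBoundedVariationOn.exists_monotoneOn_sub_monotoneOn
    have hmono : ∀ {p : ℝ → ℝ}, MonotoneOn p (Icc l b) → Measurable (clampExtend l b p) := by
      intro p hp
      refine Monotone.measurable fun x y hxy => hp (clamp_mem hlb x) (clamp_mem hlb y) ?_
      gcongr
    rw [indicator_congr (g := fun x => clampExtend l b p x - clampExtend l b q x) fun x hx => by
      rw [Pi.sub_apply, clampExtend_eqOn l b p hx, clampExtend_eqOn l b q hx]]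
    exact ((hmono hp).sub (hmono hq)).indicator measurableSet_Icc
  · simp [Icc_eq_empty hlb]

/-- Average `|g x| ≤ |g y| + V` over `y`. This is how the BV norm enters the decay estimate. -/
theorem abs_le_of_boundedVariationOn {g : ℝ → ℝ} {l b : ℝ} (hlb : l < b)
    (hg : BoundedVariationOn g (Icc l b)) {x : ℝ} (hx : x ∈ Icc l b) :
    |g x| ≤ (1 + (b - l)⁻¹) * bvNorm g (Icc l b) := by
  set V := (eVariationOn g (Icc l b)).toReal
  have hV : 0 ≤ V := ENNReal.toReal_nonneg
  have hclose : ∀ y ∈ Icc l b, |g x| ≤ |g y| + V := by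
    intro y hy
    have h1 := hg.dist_le hx hy
    rw [Real.dist_eq] at h1
    have h2 := abs_sub_abs_le_abs_sub (g x) (g y)
    linarith
  have hm := measurable_indicator_of_boundedVariationOn hg
  have hint : IntegrableOn (fun y => |g y|) (Icc l b) := by
    have h1 : IntegrableOn g (Icc l b) := by
      rw [← integrable_indicator_iff measurableSet_Icc]
      refine (integrableOn_iff_integrable_of_support_subset
        (s := Icc l b) support_indicator_subset).1 ?_
      refine Measure.integrableOn_of_bounded (M := |g x| + V) (by simp)
        hm.aestronglyMeasurable (ae_restrict_of_forall_mem measurableSet_Icc fun y hy => ?_)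
      rw [indicator_of_mem hy, Real.norm_eq_abs]
      have h1 := hg.dist_le hx hy
      rw [dist_comm, Real.dist_eq] at h1
      have h2 := abs_sub_abs_le_abs_sub (g y) (g x)
      linarith
    exact h1.abs
  have hbl : 0 < b - l := sub_pos.2 hlb
  have h1 : (b - l) * |g x| ≤ (∫ y in Icc l b, |g y|) + (b - l) * V := by
    have := setIntegral_mono_on (integrable_const (|g x|)) (hint.add (integrable_const V))
      measurableSet_Icc hclose
    rw [integral_add' hint (integrable_const V)] at this
    simpa [hlb.le] using this
  have hI : 0 ≤ ∫ y in Icc l b, |g y| := integral_nonneg fun _ => abs_nonneg _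
  rw [bvNorm]
  calc |g x| = (b - l)⁻¹ * ((b - l) * |g x|) := by field_simp
    _ ≤ (b - l)⁻¹ * ((∫ y in Icc l b, |g y|) + (b - l) * V) := by gcongr
    _ = (b - l)⁻¹ * (∫ y in Icc l b, |g y|) + V := by field_simp
    _ ≤ _ := by
      have : 0 ≤ (b - l)⁻¹ * V := by positivity
      change _ ≤ (1 + (b - l)⁻¹) * (V + ∫ y in Icc l b, |g y|)
      linarith

/-! ### Duality -/

/-- The Markov operator on densities on the set `I`. -/
def densityOp (I : Set ℝ) (T s χ : ℝ → ℝ) (f : ℝ → ℝ) (y : ℝ) : ℝ :=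
  ∫ x in I, kernelDensity T s χ x y * f x

theorem markovOp_eq_densityOp {T T' s s' χ : ℝ → ℝ} {c : ℝ}
    (hT : EqOn T T' (stateSpace T c)) (hs : EqOn s s' (stateSpace T c)) :
    markovOp T c s χ = densityOp (stateSpace T c) T' s' χ := by
  funext f y
  refine setIntegral_congr_fun measurableSet_Icc fun x hx => ?_
  simp only [kernelDensity, hT hx, hs hx]

section Duality

variable {T s χ : ℝ → ℝ} {a : ℝ} {I : Set ℝ} {f φ : ℝ → ℝ} {D : ℝ}

theorem integrable_kernelDensity (hχ : IsBump χ a) (x : ℝ) (hx : 0 < s x) :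
    Integrable fun y => kernelDensity T s χ x y :=
  ((hχ.integrable_noiseDensity.comp_div hx.ne').comp_sub_right (T x)).const_mul _

theorem integral_kernelDensity (hχ : IsBump χ a) (ha : 0 < a) (x : ℝ) (hx : 0 < s x) :
    ∫ y, kernelDensity T s χ x y = 1 := by
  have := hχ.isProbabilityMeasure ha
  have := stepOp_eq_integral_kernelDensity (T := T) (φ := fun _ => 1) hχ hx
  simpa [stepOp] using this.symm

/-- For almost every `x` the kernel is a probability density in `y`, so integrating out `y` leaves
`|f x|`. Noise-free points are harmless because they form a null set. -/
theorem integrable_kernelDensity_mul (hχ : IsBump χ a) (ha : 0 < a) (hT : Measurable T)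
    (hs : Measurable s) (hpos : ∀ᵐ x ∂volume.restrict I, 0 < s x) (hf : Integrable f) :
    Integrable (fun p : ℝ × ℝ => kernelDensity T s χ p.1 p.2 * f p.1)
      ((volume.restrict I).prod volume) := by
  have hm : AEStronglyMeasurable (fun p : ℝ × ℝ => kernelDensity T s χ p.1 p.2 * f p.1)
      ((volume.restrict I).prod volume) :=
    (measurable_kernelDensity hχ hT hs).aestronglyMeasurable.mul
      hf.restrict.aestronglyMeasurable.comp_fst
  refine (integrable_prod_iff hm).2 ⟨?_, ?_⟩
  · filter_upwards [hpos] with x hx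
    exact (integrable_kernelDensity hχ x hx).mul_const _
  · refine hf.restrict.abs.congr ?_
    filter_upwards [hpos] with x hx
    simp only [norm_mul, Real.norm_eq_abs, abs_of_nonneg (kernelDensity_nonneg hχ hx.le _)]
    rw [integral_mul_const, integral_kernelDensity hχ ha x hx, one_mul]

theorem integrable_densityOp (hχ : IsBump χ a) (ha : 0 < a) (hT : Measurable T)
    (hs : Measurable s) (hpos : ∀ᵐ x ∂volume.restrict I, 0 < s x) (hf : Integrable f) :
    Integrable (densityOp I T s χ f) :=
  (integrable_kernelDensity_mul hχ ha hT hs hpos hf).integral_prod_right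

theorem support_densityOp_subset (hχ : IsBump χ a)
    (hinv : ∀ x ∈ I, ∀ u ∈ Icc (-a) a, T x + s x * u ∈ I) :
    Function.support (densityOp I T s χ f) ⊆ I := by
  intro y hy
  by_contra hyI
  refine hy ?_
  rw [densityOp, setIntegral_eq_zero_of_forall_eq_zero]
  intro x hx
  rw [kernelDensity_eq_zero hχ, zero_mul]
  rintro u hu rfl
  exact hyI (hinv x hx u hu)

/-- Fubini, with the inner integral over `y` recognised as `stepOp`. -/
theorem integral_densityOp_mul (hχ : IsBump χ a) (ha : 0 < a) (hT : Measurable T)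
    (hs : Measurable s) (hpos : ∀ᵐ x ∂volume.restrict I, 0 < s x) (hf : Integrable f)
    (hsupp : Function.support f ⊆ I) (hφ : Measurable φ) (hD : ∀ x, |φ x| ≤ D) :
    ∫ y, densityOp I T s χ f y * φ y = ∫ x, f x * stepOp T s χ φ x := by
  have hi := integrable_kernelDensity_mul hχ ha hT hs hpos hf
  simp only [densityOp, ← integral_mul_const]
  rw [← integral_integral_swap
    (f := fun x y => kernelDensity T s χ x y * f x * φ y)]
  · rw [← setIntegral_eq_integral_of_forall_compl_eq_zero (s := I)
      (f := fun x => f x * stepOp T s χ φ x)]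
    · refine integral_congr_ae ?_
      filter_upwards [hpos] with x hx
      rw [stepOp_eq_integral_kernelDensity hχ hx, ← integral_const_mul]
      congr 1 with y
      ring
    · intro x hx
      rw [Function.notMem_support.1 fun h => hx (hsupp h), zero_mul]
  · have := hi.bdd_mul (f := fun p : ℝ × ℝ => φ p.2) (c := D)
      (hφ.comp measurable_snd).aestronglyMeasurable (ae_of_all _ fun p => hD _)
    refine this.congr (ae_of_all _ fun p => ?_)
    simp only [Function.uncurry]
    ring

theorem integral_iterate_densityOp_mul (hχ : IsBump χ a) (ha : 0 < a) (hT : Measurable T)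
    (hs : Measurable s) (hpos : ∀ᵐ x ∂volume.restrict I, 0 < s x)
    (hinv : ∀ x ∈ I, ∀ u ∈ Icc (-a) a, T x + s x * u ∈ I) (hφ : Measurable φ)
    (hD : ∀ x, |φ x| ≤ D) (t : ℕ) (hf : Integrable f) (hsupp : Function.support f ⊆ I) :
    Integrable ((densityOp I T s χ)^[t] f) ∧
      ∫ y, (densityOp I T s χ)^[t] f y * φ y = ∫ x, f x * (stepOp T s χ)^[t] φ x := by
  have := hχ.isProbabilityMeasure ha
  induction t generalizing f with
  | zero => exact ⟨hf, rfl⟩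
  | succ t ih =>
    obtain ⟨h1, h2⟩ := ih (integrable_densityOp hχ ha hT hs hpos hf)
      (support_densityOp_subset hχ hinv)
    refine ⟨h1, ?_⟩
    rw [Function.iterate_succ_apply, Function.iterate_succ_apply', h2]
    exact integral_densityOp_mul hχ ha hT hs hpos hf hsupp (measurable_iterate_stepOp hT hs hφ t)
      (abs_iterate_stepOp_le hD t)

end Duality

/-! ### Stationary measures -/

section Stationary

variable {T T' s s' χ : ℝ → ℝ} {c a : ℝ} {ν : Measure ℝ}

theorem transition_apply {x : ℝ} {A : Set ℝ} (hA : MeasurableSet A) :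
    transition T s χ x A = noiseLaw χ ((fun u => T x + s x * u) ⁻¹' A) :=
  Measure.map_apply (by fun_prop) hA

theorem IsStationary.ae_mem (hν : IsStationary T c s χ ν) : ∀ᵐ x ∂ν, x ∈ stateSpace T c := by
  rw [ae_iff]
  exact hν.concentrated

/-- Stationarity says that `ν` is the image of `ν ⊗ noiseLaw χ` under one step, so test functions
can be integrated through this image. -/
theorem IsStationary.integral_stepOp (hχ : IsBump χ a) (ha : 0 < a)
    (hν : IsStationary T c s χ ν) (hT : Measurable T') (hs : Measurable s')
    (hTT : EqOn T T' (stateSpace T c)) (hss : EqOn s s' (stateSpace T c))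
    {φ : ℝ → ℝ} (hφ : Measurable φ) {D : ℝ} (hD : ∀ x, |φ x| ≤ D) :
    ∫ x, stepOp T' s' χ φ x ∂ν = ∫ x, φ x ∂ν := by
  have := hχ.isProbabilityMeasure ha
  have := hν.prob
  have hF : Measurable fun p : ℝ × ℝ => T' p.1 + s' p.1 * p.2 := by fun_prop
  have hmap : (ν.prod (noiseLaw χ)).map (fun p : ℝ × ℝ => T' p.1 + s' p.1 * p.2) = ν := by
    ext A hA
    rw [Measure.map_apply hF hA, Measure.prod_apply (hF hA), ← hν.stationary A hA]
    refine lintegral_congr_ae ?_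
    filter_upwards [hν.ae_mem] with x hx
    rw [transition_apply hA, hTT hx, hss hx]
    rfl
  conv_rhs => rw [← hmap]
  rw [integral_map hF.aemeasurable hφ.aestronglyMeasurable, integral_prod]
  · rfl
  · exact Integrable.of_bound (hφ.comp hF).aestronglyMeasurable D (ae_of_all _ fun p => hD _)

theorem IsStationary.integral_iterate_stepOp (hχ : IsBump χ a) (ha : 0 < a)
    (hν : IsStationary T c s χ ν) (hT : Measurable T') (hs : Measurable s')
    (hTT : EqOn T T' (stateSpace T c)) (hss : EqOn s s' (stateSpace T c))
    {φ : ℝ → ℝ} (hφ : Measurable φ) {D : ℝ} (hD : ∀ x, |φ x| ≤ D) (t : ℕ) :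
    ∫ x, (stepOp T' s' χ)^[t] φ x ∂ν = ∫ x, φ x ∂ν := by
  have := hχ.isProbabilityMeasure ha
  induction t with
  | zero => rfl
  | succ t ih =>
    rw [Function.iterate_succ_apply', hν.integral_stepOp hχ ha hT hs hTT hss
      (measurable_iterate_stepOp hT hs hφ t) (abs_iterate_stepOp_le hD t), ih]

theorem isStationary_of_integral_stepOp (hχ : IsBump χ a) (ha : 0 < a) (hp : IsProbabilityMeasure ν)
    (hT : Measurable T') (hs : Measurable s') {J : Set ℝ} (hJ : J ⊆ stateSpace T c)
    (hνJ : ∀ᵐ x ∂ν, x ∈ J) (hTT : EqOn T T' J) (hss : EqOn s s' J)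
    (h : ∀ (φ : ℝ → ℝ) (D : ℝ), Measurable φ → (∀ x, |φ x| ≤ D) →
      ∫ x, stepOp T' s' χ φ x ∂ν = ∫ x, φ x ∂ν) :
    IsStationary T c s χ ν := by
  have := hχ.isProbabilityMeasure ha
  refine ⟨hp, ?_, fun A hA => ?_⟩
  · exact ae_iff.1 (hνJ.mono fun x hx => hJ hx)
  set φ : ℝ → ℝ := A.indicator 1
  have hφ : Measurable φ := measurable_one.indicator hA
  have hD : ∀ x, |φ x| ≤ 1 := fun x => by
    by_cases hx : x ∈ A <;> simp [φ, hx]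
  have hstep : ∀ x, transition T' s' χ x A = ENNReal.ofReal (stepOp T' s' χ φ x) := by
    intro x
    have hm : Measurable fun u => T' x + s' x * u := by fun_prop
    rw [transition_apply hA, stepOp]
    have : (fun u => φ (T' x + s' x * u)) = ((fun u => T' x + s' x * u) ⁻¹' A).indicator 1 := rfl
    rw [this, integral_indicator_one (hm hA), ofReal_measureReal]
  calc ∫⁻ x, transition T s χ x A ∂ν = ∫⁻ x, ENNReal.ofReal (stepOp T' s' χ φ x) ∂ν := by
        refine lintegral_congr_ae ?_
        filter_upwards [hνJ] with x hx
        rw [← hstep, transition_apply hA, transition_apply hA, hTT hx, hss hx]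
    _ = ENNReal.ofReal (∫ x, stepOp T' s' χ φ x ∂ν) := by
        rw [ofReal_integral_eq_lintegral_ofReal]
        · exact integrable_of_measurable_of_abs_le (measurable_stepOp hT hs hφ) (abs_stepOp_le hD)
        · exact ae_of_all _ fun x => integral_nonneg fun u => indicator_nonneg (by simp) _
    _ = ν A := by
        rw [h φ 1 hφ hD, integral_indicator_one hA, ofReal_measureReal]

end Stationary

theorem stepOp_mem_Icc_of_reach {T s χ φ : ℝ → ℝ} {a m M D : ℝ} (hχ : IsBump χ a) (ha : 0 < a)
    (hφ : Measurable φ) (hD : ∀ x, |φ x| ≤ D) {x : ℝ}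
    (h : ∀ u ∈ Icc (-a) a, φ (T x + s x * u) ∈ Icc m M) : stepOp T s χ φ x ∈ Icc m M := by
  have := hχ.isProbabilityMeasure ha
  have hi := integrable_shift (T := T) (s := s) (χ := χ) hφ hD x
  constructor
  · have := integral_mono_ae (integrable_const m) hi (hχ.ae_mem.mono fun u hu => (h u hu).1)
    simpa [stepOp] using this
  · have := integral_mono_ae hi (integrable_const M) (hχ.ae_mem.mono fun u hu => (h u hu).2)
    simpa [stepOp] using this

/-- A transitive map of a compact interval is surjective. -/
theorem TransitiveOn.exists_eq {T : ℝ → ℝ} {d₁ d₂ : ℝ} (h : TransitiveOn T (Icc d₁ d₂))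
    (hlt : d₁ < d₂) (hT : ContinuousOn T (Icc d₁ d₂))
    (hmaps : MapsTo T (Icc d₁ d₂) (Icc d₁ d₂)) {y : ℝ} (hy : y ∈ Icc d₁ d₂) :
    ∃ x ∈ Icc d₁ d₂, T x = y := by
  by_contra hcon
  have hO : IsOpen (T '' Icc d₁ d₂)ᶜ :=
    (isCompact_Icc.image_of_continuousOn hT).isClosed.isOpen_compl
  have hyO : y ∈ (T '' Icc d₁ d₂)ᶜ := hcon
  rw [← closure_Ioo hlt.ne] at hy
  obtain ⟨p, hpO, hp⟩ := mem_closure_iff.1 hy _ hO hyO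
  obtain ⟨η, hη, hball⟩ := Metric.isOpen_iff.1 (hO.inter isOpen_Ioo) p ⟨hpO, hp⟩
  have hmem : ∀ v, |v - p| < η → v ∈ (T '' Icc d₁ d₂)ᶜ ∩ Ioo d₁ d₂ := fun v hv =>
    hball (by rwa [Metric.mem_ball, Real.dist_eq])
  have habs₁ : |p - η / 2 - p| < η := by rw [abs_lt]; constructor <;> linarith
  have habs₂ : |p + η / 2 - p| < η := by rw [abs_lt]; constructor <;> linarith
  -- Transitivity admits `t = 0`; disjoint halves of a ball of missed values exclude it, and `t ≥ 1`
  -- makes a missed value a value.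
  obtain ⟨t, v, hvU, hvV, hvX⟩ := h (Metric.ball p η ∩ Iio p) (Metric.ball p η ∩ Ioi p)
    (Metric.isOpen_ball.inter isOpen_Iio) (Metric.isOpen_ball.inter isOpen_Ioi)
    ⟨p - η / 2, ⟨by rwa [Metric.mem_ball, Real.dist_eq], by simp only [mem_Iio]; linarith⟩,
      Ioo_subset_Icc_self (hmem _ habs₁).2⟩
    ⟨p + η / 2, ⟨by rwa [Metric.mem_ball, Real.dist_eq], by simp only [mem_Ioi]; linarith⟩,
      Ioo_subset_Icc_self (hmem _ habs₂).2⟩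
  cases t with
  | zero => exact lt_asymm (show v < p from hvU.2) (show p < v from hvV.2)
  | succ t =>
    rw [mem_preimage, Function.iterate_succ_apply'] at hvU
    exact (hball hvU.1).1 ⟨_, hmaps.iterate t hvX, rfl⟩

/-! ### The deterministic map and the range of one step -/

section System

variable {T : ℝ → ℝ} {c d₁ d₂ : ℝ} {σ : ℕ → ℝ → ℝ} {χ : ℝ → ℝ} {a : ℝ} {n : ℕ}

theorem IsAdmissibleMap.gap_pos (h : IsAdmissibleMap T c d₁ d₂) : 0 < gap T c :=
  sub_pos.2 h.max_lt_one

theorem IsAdmissibleMap.gap_le_one (h : IsAdmissibleMap T c d₁ d₂) : gap T c ≤ 1 := by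
  have := (h.mapsTo h.max_mem).1
  rw [gap]; linarith

theorem IsAdmissibleMap.le_max (h : IsAdmissibleMap T c d₁ d₂) {x : ℝ} (hx : x ∈ Icc (0 : ℝ) 1) :
    T x ≤ T c := by
  by_cases hxc : x = c
  · rw [hxc]
  · exact (h.max_unique x hx hxc).le

theorem IsAdmissibleMap.map_zero_nonneg (h : IsAdmissibleMap T c d₁ d₂) : 0 ≤ T 0 :=
  (h.mapsTo ⟨le_rfl, zero_le_one⟩).1

theorem IsAdmissibleMap.map_zero_le (h : IsAdmissibleMap T c d₁ d₂) {x : ℝ}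
    (hx : x ∈ Icc (-(gap T c)) 0) : T 0 ≤ T x :=
  h.antitoneOn hx ⟨by linarith [h.gap_pos], le_rfl⟩ hx.2

theorem IsAdmissibleMap.map_mem (h : IsAdmissibleMap T c d₁ d₂) {x : ℝ}
    (hx : x ∈ stateSpace T c) : T x ∈ Icc 0 (T c) := by
  rcases le_total 0 x with h0 | h0
  · exact ⟨(h.mapsTo ⟨h0, hx.2⟩).1, h.le_max ⟨h0, hx.2⟩⟩
  · have hx' : x ∈ Icc (-(gap T c)) 0 := ⟨hx.1, h0⟩
    refine ⟨h.map_zero_nonneg.trans (h.map_zero_le hx'), ?_⟩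
    exact (h.antitoneOn ⟨le_rfl, by linarith [h.gap_pos]⟩ hx' hx.1).trans h.left_lt.le

theorem IsAdmissibleMap.transitiveOn (h : IsAdmissibleMap T c d₁ d₂) :
    TransitiveOn T (Icc d₁ d₂) := by
  simpa using h.transitive 1 le_rfl

theorem IsAdmissibleMap.Icc_subset (h : IsAdmissibleMap T c d₁ d₂) :
    Icc (0 : ℝ) 1 ⊆ stateSpace T c :=
  Icc_subset_Icc_left (by linarith [h.gap_pos])

theorem IsAdmissibleMap.exists_preimage (h : IsAdmissibleMap T c d₁ d₂) {y : ℝ}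
    (hy : y ∈ Icc d₁ d₂) : ∃ x ∈ Icc d₁ d₂, T x = y :=
  h.transitiveOn.exists_eq h.lt (h.continuousOn.mono (h.subset.trans h.Icc_subset))
    h.forward_invariant hy

/-- By surjectivity of `T` on the transitive interval, `d₂` is itself a value of `T`. -/
theorem IsAdmissibleMap.right_le (h : IsAdmissibleMap T c d₁ d₂) : d₂ ≤ T c := by
  obtain ⟨x, hx, hxd⟩ := h.exists_preimage ⟨h.lt.le, le_rfl⟩
  exact hxd ▸ h.le_max (h.subset hx)

theorem IsAdmissibleMap.max_lt (h : IsAdmissibleMap T c d₁ d₂) : T c < 1 - gap T c / 2 := by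
  have := h.gap_pos
  rw [gap] at *; linarith

namespace IsRandomSystem

variable (hS : IsRandomSystem T c d₁ d₂ σ χ a n)

include hS

theorem amp_continuousOn : ContinuousOn (σ n) (stateSpace T c) :=
  hS.amplitude.continuousOn n hS.index_pos

theorem amp_nonneg {x : ℝ} (hx : x ∈ stateSpace T c) : 0 ≤ σ n x :=
  hS.amplitude.nonneg n hS.index_pos x hx

theorem amp_le {x : ℝ} (hx : x ∈ stateSpace T c) : σ n x ≤ sigmaMax T c (σ n) :=
  le_csSup (isCompact_Icc.image_of_continuousOn hS.amp_continuousOn).bddAbove ⟨x, hx, rfl⟩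

theorem sigmaMax_pos : 0 < sigmaMax T c (σ n) := by
  have hx : (1 / 2 : ℝ) ∈ stateSpace T c := hS.map.Icc_subset (by constructor <;> norm_num)
  exact (hS.amplitude.pos n hS.index_pos _ hx (by norm_num) (by norm_num)).trans_le (hS.amp_le hx)

theorem mul_amp_le_of_bound {m : ℝ} (h : a ≤ 1 / sigmaMax T c (σ n) * m) {x : ℝ}
    (hx : x ∈ stateSpace T c) : a * σ n x ≤ m := by
  have hm := hS.sigmaMax_pos
  rw [one_div, ← div_eq_inv_mul, le_div_iff₀ hm] at h
  exact (mul_le_mul_of_nonneg_left (hS.amp_le hx) hS.a_pos.le).trans h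

theorem mul_amp_le {x : ℝ} (hx : x ∈ stateSpace T c) : a * σ n x ≤ gap T c / 2 := by
  rcases hS.cases with ⟨ε, h⟩ | h
  · exact hS.mul_amp_le_of_bound h.bound hx
  · exact (hS.mul_amp_le_of_bound h.bound hx).trans (min_le_left _ _)

theorem lower_le {x : ℝ} (hx : x ∈ stateSpace T c) {u : ℝ} (hu : u ∈ Icc (-a) a) :
    T x - a * σ n x ≤ T x + σ n x * u := by
  nlinarith [hS.amp_nonneg hx, hu.1]

/-- After one step the chain is in `[-Γ/2, 1 - Γ/2]`. -/
theorem step_mem {x : ℝ} (hx : x ∈ stateSpace T c) {u : ℝ} (hu : u ∈ Icc (-a) a) :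
    T x + σ n x * u ∈ Icc (-(gap T c / 2)) (1 - gap T c / 2) := by
  have h1 := hS.lower_le hx hu
  have h2 := hS.mul_amp_le hx
  have h3 := hS.map.map_mem hx
  have h4 : σ n x * u ≤ a * σ n x := by nlinarith [hS.amp_nonneg hx, hu.2]
  constructor
  · linarith [h3.1]
  · have : T c = 1 - gap T c := by rw [gap]; ring
    linarith [h3.2]

theorem core_subset : Icc (-(gap T c / 2)) (1 - gap T c / 2) ⊆ stateSpace T c :=
  Icc_subset_Icc (by linarith [hS.map.gap_pos]) (by linarith [hS.map.gap_pos])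

theorem step_mem_stateSpace {x : ℝ} (hx : x ∈ stateSpace T c) {u : ℝ} (hu : u ∈ Icc (-a) a) :
    T x + σ n x * u ∈ stateSpace T c :=
  hS.core_subset (hS.step_mem hx hu)

end IsRandomSystem

/-- The map, extended continuously to the line. -/
def extMap (T : ℝ → ℝ) (c : ℝ) : ℝ → ℝ := clampExtend (-(gap T c)) 1 T

/-- The amplitude, extended continuously to the line. -/
def extAmp (T : ℝ → ℝ) (c : ℝ) (s : ℝ → ℝ) : ℝ → ℝ := clampExtend (-(gap T c)) 1 s

theorem extMap_eqOn : EqOn T (extMap T c) (stateSpace T c) := clampExtend_eqOn _ _ _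

theorem extAmp_eqOn {s : ℝ → ℝ} : EqOn s (extAmp T c s) (stateSpace T c) := clampExtend_eqOn _ _ _

theorem ext_step_eq {s : ℝ → ℝ} {x : ℝ} (hx : x ∈ stateSpace T c) (u : ℝ) :
    extMap T c x + extAmp T c s x * u = T x + s x * u := by
  rw [← extMap_eqOn hx, ← extAmp_eqOn hx]

theorem IsAdmissibleMap.measurable_extMap (h : IsAdmissibleMap T c d₁ d₂) :
    Measurable (extMap T c) :=
  (continuous_clampExtend (by linarith [h.gap_pos]) h.continuousOn).measurable

/-- The operator on bounded functions of the extended chain converges exponentially on `K` to `μ`. -/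
def ConvergesOn (T : ℝ → ℝ) (c : ℝ) (s χ : ℝ → ℝ) (μ : Measure ℝ) (K : Set ℝ) : Prop :=
  ∃ r C : ℝ, 0 < r ∧ r < 1 ∧ 0 < C ∧ ∀ (φ : ℝ → ℝ) (D : ℝ), Measurable φ → (∀ x, |φ x| ≤ D) →
    ∀ (t : ℕ), ∀ x ∈ K,
      |(stepOp (extMap T c) (extAmp T c s) χ)^[t] φ x - ∫ y, φ y ∂μ| ≤ C * r ^ t * D

/-! ### Invariant intervals, uniqueness and decay of correlations -/

namespace IsRandomSystem

variable (hS : IsRandomSystem T c d₁ d₂ σ χ a n)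

include hS

theorem measurable_extAmp : Measurable (extAmp T c (σ n)) :=
  (continuous_clampExtend (by linarith [hS.map.gap_pos]) hS.amp_continuousOn).measurable

/-- An invariant interval inside `(0, 1)` that contains `[d₁, d₂]` carries a stationary measure
with Lipschitz density, to which the chain converges. -/
theorem exists_stationary {α : ℝ} (hα : 0 < α) (hαβ : α < 1 - gap T c / 2) (hd : α ≤ d₁)
    (hinv : ∀ x ∈ Icc α (1 - gap T c / 2), ∀ u ∈ Icc (-a) a,
      T x + σ n x * u ∈ Icc α (1 - gap T c / 2)) :
    ∃ (μ : Measure ℝ) (ρ : ℝ → ℝ), (∀ x, 0 ≤ ρ x) ∧ BoundedVariationOn ρ (stateSpace T c) ∧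
      μ = (volume.restrict (stateSpace T c)).withDensity (fun x => ENNReal.ofReal (ρ x)) ∧
      IsStationary T c (σ n) χ μ ∧ Icc d₁ d₂ ⊆ μ.support ∧
      ConvergesOn T c (σ n) χ μ (Icc α (1 - gap T c / 2)) := by
  set β := 1 - gap T c / 2
  have hΓ := hS.map.gap_pos
  have hβ1 : β < 1 := by simp only [β]; linarith
  have hJ01 : Icc α β ⊆ Icc (0 : ℝ) 1 := Icc_subset_Icc hα.le hβ1.le
  have hJI : Icc α β ⊆ stateSpace T c := hJ01.trans hS.map.Icc_subset
  have hX : Icc d₁ d₂ ⊆ Icc α β := Icc_subset_Icc hd (hS.map.right_le.trans hS.map.max_lt.le)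
  obtain ⟨x₀, hx₀, hmin⟩ := (isCompact_Icc (a := α) (b := β)).exists_isMinOn
    (nonempty_Icc.2 hαβ.le) (hS.amp_continuousOn.mono hJI)
  have hmin0 : 0 < σ n x₀ := hS.amplitude.pos n hS.index_pos x₀ (hJI hx₀)
    (hα.trans_le hx₀.1).ne' (hx₀.2.trans_lt hβ1).ne
  -- Clamping to `[α, β]`, rather than to the state space as in `extMap`, keeps the amplitude away
  -- from its possible zeros `0` and `1`. The two extensions agree on this invariant interval.
  set T' := clampExtend α β T
  set s' := clampExtend α β (σ n)
  have hTT : EqOn T T' (Icc α β) := clampExtend_eqOn α β T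
  have hss : EqOn (σ n) s' (Icc α β) := clampExtend_eqOn α β (σ n)
  have hmap : MapsTo T (Icc α β) (Icc α β) := fun x hx => by
    simpa using hinv x hx 0 ⟨by linarith [hS.a_pos], hS.a_pos.le⟩
  have hiter : ∀ k, ∀ x ∈ Icc α β, T'^[k] x = T^[k] x := by
    intro k
    induction k with
    | zero => exact fun x _ => rfl
    | succ k ih =>
      intro x hx
      rw [Function.iterate_succ_apply, Function.iterate_succ_apply, ← hTT hx, ih _ (hmap hx)]
  have htrap : IsTrapped T' s' χ a (σ n x₀) α β d₁ d₂ :=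
    { bump := hS.bump
      a_pos := hS.a_pos
      continuous_map := continuous_clampExtend hαβ.le (hS.map.continuousOn.mono hJI)
      continuous_amp := continuous_clampExtend hαβ.le (hS.amp_continuousOn.mono hJI)
      amp_min_pos := hmin0
      amp_ge := fun x => hmin (clamp_mem hαβ.le x)
      enters := fun x u hu => hinv _ (clamp_mem hαβ.le x) u hu
      bounds_lt := hαβ
      lt := hS.map.lt
      subset := hX
      forward_invariant := hS.map.forward_invariant.congr (hTT.mono hX)
      transitive := by
        intro U V hU hV hUX hVX
        obtain ⟨t, v, hvU, hv⟩ := hS.map.transitiveOn U V hU hV hUX hVX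
        refine ⟨t, v, ?_, hv⟩
        rwa [mem_preimage, hiter t v (hX hv.2)]
      absorbing := by
        have h1 := ae_restrict_of_ae_restrict_of_subset hJ01 hS.map.absorbing
        filter_upwards [h1, ae_restrict_mem measurableSet_Icc] with x hx hxJ U hU hXU
        obtain ⟨k, hk⟩ := hx U hU hXU
        exact ⟨k, by rwa [hiter k x hxJ]⟩ }
  obtain ⟨ρ, ⟨L, hL⟩, hnn, hzero, hone, hstat, r, C, hr, hr1, hC, hdec⟩ := htrap.exists_density
  set μ := volume.withDensity fun x => ENNReal.ofReal (ρ x) with hμ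
  have hρm : Measurable fun x => ENNReal.ofReal (ρ x) := hL.continuous.measurable.ennreal_ofReal
  have hμint : ∀ φ : ℝ → ℝ, ∫ x, φ x ∂μ = ∫ x, φ x * ρ x := by
    intro φ
    rw [hμ, integral_withDensity_eq_integral_toReal_smul hρm (by simp)]
    simp [ENNReal.toReal_ofReal (hnn _), mul_comm]
  have hρi : Integrable ρ := by
    by_contra hn
    rw [integral_undef hn] at hone
    exact zero_ne_one hone
  have hμp : IsProbabilityMeasure μ := by
    constructor
    rw [hμ, withDensity_apply _ MeasurableSet.univ, Measure.restrict_univ,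
      ← ofReal_integral_eq_lintegral_ofReal hρi (ae_of_all _ hnn), hone, ENNReal.ofReal_one]
  have hμJ : ∀ᵐ x ∂μ, x ∈ Icc α β := by
    rw [hμ, ae_withDensity_iff hρm]
    refine ae_of_all _ fun x hx => ?_
    by_contra h
    exact hx (by simp [hzero x h])
  refine ⟨μ, ρ, hnn, ?_, ?_, ?_, ?_, r, C, hr, hr1, hC, ?_⟩
  · have h1 : (-(gap T c)) ∈ stateSpace T c := ⟨le_rfl, by linarith⟩
    have h2 : (1 : ℝ) ∈ stateSpace T c := ⟨by linarith, le_rfl⟩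
    have := hL.locallyBoundedVariationOn (stateSpace T c) _ _ h1 h2
    rwa [stateSpace, inter_self] at this
  · rw [hμ, ← withDensity_indicator (show MeasurableSet (stateSpace T c) from measurableSet_Icc)]
    congr 1
    funext x
    by_cases hx : x ∈ stateSpace T c
    · rw [indicator_of_mem hx]
    · rw [indicator_of_notMem hx, hzero x fun h => hx (hJI h), ENNReal.ofReal_zero]
  · refine isStationary_of_integral_stepOp hS.bump hS.a_pos hμp htrap.continuous_map.measurable
      htrap.continuous_amp.measurable hJI hμJ hTT hss fun φ D hφ hD => ?_
    rw [hμint, hμint, hstat φ D hφ hD]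
  · intro x hx
    rw [Measure.mem_support_iff_forall]
    intro U hU
    obtain ⟨V, hVU, hV, hxV⟩ := mem_nhds_iff.1 hU
    exact (htrap.withDensity_pos hL.continuous hnn hone hstat hV ⟨x, hxV, hx⟩).trans_le
      (measure_mono hVU)
  · intro φ D hφ hD t x hx
    have hcongr := iterate_stepOp_congr (φ := φ) (ψ := φ) hS.bump
      (fun y hy => (hTT hy).symm.trans (extMap_eqOn (c := c) (hJI hy)))
      (fun y hy => (hss hy).symm.trans (extAmp_eqOn (T := T) (c := c) (hJI hy)))
      (fun y _ u hu => htrap.enters y u hu) (fun _ _ => rfl) t hx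
    rw [← hcongr, hμint]
    exact hdec φ D hφ hD t x

/-- A stationary measure on a set where the chain converges to `μ` is `μ`. -/
theorem eq_of_convergesOn {μ ν : Measure ℝ} {K : Set ℝ} [IsProbabilityMeasure μ]
    (hK : ConvergesOn T c (σ n) χ μ K) (hν : IsStationary T c (σ n) χ ν)
    (hνK : ∀ᵐ x ∂ν, x ∈ K) : ν = μ := by
  have hprob := hS.bump.isProbabilityMeasure hS.a_pos
  have := hν.prob
  obtain ⟨r, C, hr, hr1, hC, hdec⟩ := hK
  ext A hA
  set φ : ℝ → ℝ := A.indicator 1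
  have hφ : Measurable φ := measurable_one.indicator hA
  have hD : ∀ x, |φ x| ≤ 1 := fun x => by
    by_cases hx : x ∈ A <;> simp [φ, hx]
  -- The left side does not depend on `t`, since `∫ φ dν = ∫ Q^t φ dν`; letting `t → ∞` forces
  -- equality.
  have hle : ∀ t : ℕ, |∫ x, φ x ∂ν - ∫ x, φ x ∂μ| ≤ C * r ^ t * 1 := by
    intro t
    rw [← hν.integral_iterate_stepOp hS.bump hS.a_pos hS.map.measurable_extMap
      hS.measurable_extAmp extMap_eqOn extAmp_eqOn hφ hD t]
    have hint : Integrable ((stepOp (extMap T c) (extAmp T c (σ n)) χ)^[t] φ) ν :=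
      integrable_of_measurable_of_abs_le
        (measurable_iterate_stepOp hS.map.measurable_extMap hS.measurable_extAmp hφ t)
        (abs_iterate_stepOp_le hD t)
    have h1 := norm_integral_le_of_norm_le_const (μ := ν) (C := C * r ^ t * 1)
      (f := fun x => (stepOp (extMap T c) (extAmp T c (σ n)) χ)^[t] φ x - ∫ x, φ x ∂μ)
      (hνK.mono fun x hx => hdec φ 1 hφ hD t x hx)
    rw [integral_sub hint (integrable_const _)] at h1
    simpa using h1
  have h0 : Tendsto (fun t : ℕ => C * r ^ t * 1) atTop (𝓝 0) := by
    simpa using (tendsto_pow_atTop_nhds_zero_of_lt_one hr.le hr1).const_mul C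
  have heq : ∫ x, φ x ∂ν = ∫ x, φ x ∂μ := by
    have := ge_of_tendsto' h0 hle
    exact sub_eq_zero.1 (abs_nonpos_iff.1 this)
  rw [integral_indicator_one hA, integral_indicator_one hA] at heq
  exact (measureReal_eq_measureReal_iff).1 heq

/-- Convergence of the operator on bounded functions implies decay of correlations. -/
theorem exponentialDecayOn {μ : Measure ℝ} {l b : ℝ} (hlb : l < b)
    (hK : Icc l b ⊆ stateSpace T c) (hconv : ConvergesOn T c (σ n) χ μ (Icc l b)) :
    ExponentialDecayOn T c (σ n) χ μ (Icc l b) := by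
  have hprob := hS.bump.isProbabilityMeasure hS.a_pos
  have hTm := hS.map.measurable_extMap
  have hsm := hS.measurable_extAmp
  obtain ⟨r, C, hr, hr1, hC, hdec⟩ := hconv
  have hbl : 0 < b - l := sub_pos.2 hlb
  refine ⟨r, C * (1 + (b - l)⁻¹), hr, hr1, by positivity, fun f g hf hsupp hg t => ?_⟩
  -- `𝓛^t f` may leave `[l, b]`, so the duality runs on the whole state space with `g` cut off. On
  -- the dual side `f` restricts the integral to `[l, b]`, where the convergence is known.
  set φ := (Icc l b).indicator g
  set D := (1 + (b - l)⁻¹) * bvNorm g (Icc l b)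
  have hφ : Measurable φ := measurable_indicator_of_boundedVariationOn hg
  have hD : ∀ x, |φ x| ≤ D := by
    intro x
    by_cases hx : x ∈ Icc l b
    · simp only [φ, indicator_of_mem hx]
      exact abs_le_of_boundedVariationOn hlb hg hx
    · simp only [φ, indicator_of_notMem hx, abs_zero]
      exact (abs_nonneg _).trans (abs_le_of_boundedVariationOn hlb hg (left_mem_Icc.2 hlb.le))
  have hpos : ∀ᵐ x ∂volume.restrict (stateSpace T c), 0 < extAmp T c (σ n) x := by
    have h0 : ∀ᵐ x : ℝ, x ≠ 0 := by simp [ae_iff]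
    have h1 : ∀ᵐ x : ℝ, x ≠ 1 := by simp [ae_iff]
    filter_upwards [ae_restrict_mem measurableSet_Icc, ae_restrict_of_ae h0,
      ae_restrict_of_ae h1] with x hx hx0 hx1
    rw [← extAmp_eqOn hx]
    exact hS.amplitude.pos n hS.index_pos x hx hx0 hx1
  obtain ⟨hLi, hdual⟩ := integral_iterate_densityOp_mul hS.bump hS.a_pos hTm hsm hpos
    (fun x hx u hu => by rw [ext_step_eq hx]; exact hS.step_mem_stateSpace hx hu) hφ hD t hf
    (hsupp.trans hK)
  rw [← markovOp_eq_densityOp extMap_eqOn extAmp_eqOn] at hLi hdual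
  set F := (markovOp T c (σ n) χ)^[t] f
  have hind : (Icc l b).indicator (fun x => F x * g x) = fun x => F x * φ x := by
    funext x
    by_cases hx : x ∈ Icc l b <;> simp [φ, hx]
  have hFφ : Integrable fun x => F x * φ x := by
    have := hLi.bdd_mul (f := φ) hφ.aestronglyMeasurable (ae_of_all _ hD)
    simpa only [mul_comm] using this
  refine ⟨?_, ?_⟩
  · rw [← integrable_indicator_iff measurableSet_Icc, hind]
    exact hFφ
  have hg' : ∫ x in Icc l b, g x ∂μ = ∫ x, φ x ∂μ := (integral_indicator measurableSet_Icc).symm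
  rw [← integral_indicator measurableSet_Icc, hind, hdual, hg', ← integral_mul_const,
    ← integral_sub]
  · have hbound : ∀ x, ‖f x * (stepOp (extMap T c) (extAmp T c (σ n)) χ)^[t] φ x -
        f x * ∫ x, φ x ∂μ‖ ≤ |f x| * (C * r ^ t * D) := by
      intro x
      rw [← mul_sub, norm_mul, Real.norm_eq_abs, Real.norm_eq_abs]
      by_cases hx : x ∈ Icc l b
      · exact mul_le_mul_of_nonneg_left (hdec φ D hφ hD t x hx) (abs_nonneg _)
      · have hfx : f x = 0 := Function.notMem_support.1 fun h => hx (hsupp h)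
        simp [hfx]
    refine (norm_integral_le_of_norm_le (hf.abs.mul_const _) (ae_of_all _ hbound)).trans ?_
    rw [integral_mul_const]
    simp only [D]
    apply le_of_eq
    ring
  · have := hf.bdd_mul (f := (stepOp (extMap T c) (extAmp T c (σ n)) χ)^[t] φ)
      (measurable_iterate_stepOp hTm hsm hφ t).aestronglyMeasurable
      (ae_of_all _ (abs_iterate_stepOp_le hD t))
    simpa only [mul_comm] using this
  · exact hf.mul_const _

/-- If the chain is in `K` after `t` steps from any state, then stationary measures live on `K`. -/
theorem ae_mem_of_iterate_eq_zero {ν : Measure ℝ} (hν : IsStationary T c (σ n) χ ν) {K : Set ℝ}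
    (hK : MeasurableSet K) (t : ℕ) (h : ∀ x ∈ stateSpace T c,
      (stepOp (extMap T c) (extAmp T c (σ n)) χ)^[t] (Kᶜ.indicator 1) x = 0) :
    ∀ᵐ x ∂ν, x ∈ K := by
  have := hν.prob
  have hD : ∀ x, |(Kᶜ.indicator 1 : ℝ → ℝ) x| ≤ 1 := fun x => by
    by_cases hx : x ∈ K <;> simp [hx]
  have h1 := hν.integral_iterate_stepOp hS.bump hS.a_pos hS.map.measurable_extMap
    hS.measurable_extAmp extMap_eqOn extAmp_eqOn
    ((measurable_one (α := ℝ)).indicator hK.compl) hD t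
  rw [integral_eq_zero_of_ae (hν.ae_mem.mono h), integral_indicator_one hK.compl] at h1
  exact ae_iff.2 ((measureReal_eq_zero_iff).1 h1.symm)

theorem ae_mem_core {ν : Measure ℝ} (hν : IsStationary T c (σ n) χ ν) :
    ∀ᵐ x ∂ν, x ∈ Icc (-(gap T c / 2)) (1 - gap T c / 2) := by
  refine hS.ae_mem_of_iterate_eq_zero hν measurableSet_Icc 1 fun x hx => ?_
  rw [Function.iterate_one, stepOp, integral_eq_zero_of_ae]
  filter_upwards [hS.bump.ae_mem] with u hu
  rw [ext_step_eq hx, indicator_of_notMem]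
  · rfl
  · exact not_not.2 (hS.step_mem hx hu)

/-- A bounded function that increases along the chain is invariant almost everywhere. -/
theorem stepOp_ae_eq_of_le {ν : Measure ℝ} (hν : IsStationary T c (σ n) χ ν) {φ : ℝ → ℝ} {D : ℝ}
    (hφ : Measurable φ) (hD : ∀ x, |φ x| ≤ D)
    (h : ∀ᵐ x ∂ν, φ x ≤ stepOp (extMap T c) (extAmp T c (σ n)) χ φ x) :
    ∀ᵐ x ∂ν, φ x = stepOp (extMap T c) (extAmp T c (σ n)) χ φ x := by
  have := hν.prob
  have hprob := hS.bump.isProbabilityMeasure hS.a_pos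
  refine (integral_eq_iff_of_ae_le (integrable_of_measurable_of_abs_le hφ hD)
    (integrable_of_measurable_of_abs_le (measurable_stepOp hS.map.measurable_extMap
      hS.measurable_extAmp hφ) (abs_stepOp_le hD)) h).1 ?_
  exact (hν.integral_stepOp hS.bump hS.a_pos hS.map.measurable_extMap
    hS.measurable_extAmp extMap_eqOn extAmp_eqOn hφ hD).symm

end IsRandomSystem

end System

namespace IsRandomSystem

variable {T : ℝ → ℝ} {c d₁ d₂ : ℝ} {σ : ℕ → ℝ → ℝ} {χ : ℝ → ℝ} {a : ℝ} {n : ℕ}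
  (hS : IsRandomSystem T c d₁ d₂ σ χ a n)

include hS

theorem lower_continuousOn : ContinuousOn (fun x => T x - a * σ n x) (stateSpace T c) :=
  hS.map.continuousOn.sub (continuousOn_const.mul hS.amp_continuousOn)

/-! ### The case of a fixed point at the origin -/

section FixedOrigin

variable {ε : ℝ} (h : FixedOriginCase T c (σ n) a ε)

include h

theorem eps_subset : Icc ε (1 - gap T c / 2) ⊆ stateSpace T c :=
  (Icc_subset_Icc_left (by linarith [h.eps_pos, hS.map.gap_pos])).trans hS.core_subset

/-- The hypothesis covers only the open interval; continuity adds the endpoints at the cost of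
strictness. -/
theorem eps_le_lower {x : ℝ} (hx : x ∈ Icc ε (1 - gap T c / 2)) : ε ≤ T x - a * σ n x := by
  have hcl : x ∈ closure (Ioo ε (1 - gap T c / 2)) := by rwa [closure_Ioo h.eps_lt.ne]
  exact ContinuousWithinAt.closure_le hcl continuousWithinAt_const
    ((hS.lower_continuousOn x (hS.eps_subset h hx)).mono
      (Ioo_subset_Icc_self.trans (hS.eps_subset h)))
    fun y hy => (h.lower_gt_eps y hy).le

theorem eps_invariant {x : ℝ} (hx : x ∈ Icc ε (1 - gap T c / 2)) {u : ℝ} (hu : u ∈ Icc (-a) a) :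
    T x + σ n x * u ∈ Icc ε (1 - gap T c / 2) :=
  ⟨(hS.eps_le_lower h hx).trans (hS.lower_le (hS.eps_subset h hx) hu),
    (hS.step_mem (hS.eps_subset h hx) hu).2⟩

/-- Otherwise take `p` between `d₁` and `min ε d₂`. Points of `[d₁, d₂]` above `p` stay above it, as
`T` pushes up below `ε` and stays above `ε` afterwards; this contradicts transitivity. -/
theorem eps_le_left : ε ≤ d₁ := by
  by_contra! hlt
  obtain ⟨p, hp₁, hp₂⟩ := exists_between (lt_min hlt hS.map.lt)
  have hd0 : 0 ≤ d₁ := (hS.map.subset ⟨le_rfl, hS.map.lt.le⟩).1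
  have hstep : ∀ y ∈ Icc d₁ d₂, p < y → p < T y := by
    intro y hy hpy
    have hyI := hS.map.Icc_subset (hS.map.subset hy)
    have hamp := mul_nonneg hS.a_pos.le (hS.amp_nonneg hyI)
    rcases lt_or_ge y ε with hyε | hyε
    · linarith [h.lower_gt_self y ⟨by linarith, hyε⟩]
    · linarith [hS.eps_le_lower h ⟨hyε, hy.2.trans (hS.map.right_le.trans hS.map.max_lt.le)⟩,
        hp₂.trans_le (min_le_left _ _)]
  have hiter : ∀ t : ℕ, ∀ y ∈ Icc d₁ d₂, p < y → p < T^[t] y := by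
    intro t
    induction t with
    | zero => exact fun y _ hy => hy
    | succ t ih => exact fun y hy hpy => ih _ (hS.map.forward_invariant hy) (hstep y hy hpy)
  obtain ⟨t, v, hvU, hvV, hvX⟩ := hS.map.transitiveOn (Iio p) (Ioi p) isOpen_Iio isOpen_Ioi
    ⟨d₁, hp₁, le_rfl, hS.map.lt.le⟩
    ⟨d₂, hp₂.trans_le (min_le_right _ _), hS.map.lt.le, le_rfl⟩
  exact lt_asymm (show T^[t] v < p from hvU) (hiter t v hvX hvV)

/-- The indicator of `(0, ∞)` and the truncation `max 0 (min x ε)` do not decrease in mean, so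
`stepOp_ae_eq_of_le` makes them invariant. Strict increase at negative states and on `(0, ε)`,
respectively, then excludes these states. -/
theorem ae_mem_eps {ν : Measure ℝ} (hν : IsStationary T c (σ n) χ ν) (h0 : ν {0} = 0) :
    ∀ᵐ x ∂ν, x ∈ Icc ε (1 - gap T c / 2) := by
  have hprob := hS.bump.isProbabilityMeasure hS.a_pos
  have hcore := hS.ae_mem_core hν
  have hne : ∀ᵐ x ∂ν, x ≠ 0 := by
    rw [ae_iff]; simpa using h0
  have hnonneg : ∀ᵐ x ∂ν, 0 ≤ x := by
    set φ : ℝ → ℝ := (Ioi 0).indicator 1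
    have hφ : Measurable φ := measurable_one.indicator measurableSet_Ioi
    have hφmem : ∀ x, φ x ∈ Icc (0 : ℝ) 1 := fun x => by
      by_cases hx : 0 < x <;> simp [φ, hx]
    have hD : ∀ x, |φ x| ≤ 1 := fun x => by rw [abs_of_nonneg (hφmem x).1]; exact (hφmem x).2
    have hle : ∀ᵐ x ∂ν, φ x ≤ stepOp (extMap T c) (extAmp T c (σ n)) χ φ x := by
      filter_upwards [hcore] with x hx
      have hxI := hS.core_subset hx
      refine (stepOp_mem_Icc_of_reach (M := 1) hS.bump hS.a_pos hφ hD fun u hu => ?_).1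
      rcases lt_or_ge 0 x with hx0 | hx0
      · have hp : 0 < T x + σ n x * u :=
          (h.lower_pos x ⟨hx0, hx.2⟩).trans_le (hS.lower_le hxI hu)
        rw [ext_step_eq hxI]
        simp [φ, hp, hx0]
      · have : φ x = 0 := by simp [φ, hx0]
        rw [this]
        exact hφmem _
    -- At a negative state `T x ≥ 0` and the amplitude is positive, so positive noise, which has
    -- positive probability, leads into `(0, ∞)`.
    filter_upwards [hS.stepOp_ae_eq_of_le hν hφ hD hle, hcore] with x hx hxc
    by_contra! hx0
    have hxI := hS.core_subset hxc
    have hφx : φ x = 0 := by simp [φ, hx0.le]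
    rw [hφx] at hx
    have hpos : 0 < stepOp (extMap T c) (extAmp T c (σ n)) χ φ x := by
      rw [stepOp, integral_pos_iff_support_of_nonneg (fun u => (hφmem _).1)
        (integrable_shift hφ hD x)]
      refine (hS.bump.noiseLaw_pos hS.a_pos (V := Ioi 0) isOpen_Ioi
        ⟨a, hS.a_pos, by linarith [hS.a_pos], le_rfl⟩).trans_le (measure_mono fun u hu => ?_)
      have hs := hS.amplitude.pos n hS.index_pos x hxI hx0.ne (by linarith)
      have hp : 0 < T x + σ n x * u :=
        add_pos_of_nonneg_of_pos (hS.map.map_mem hxI).1 (mul_pos hs hu)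
      rw [Function.mem_support, ext_step_eq hxI]
      simp [φ, hp]
    exact hpos.ne hx
  set φ : ℝ → ℝ := fun x => max 0 (min x ε)
  have hφ : Measurable φ := by fun_prop
  have hφmem : ∀ x, φ x ∈ Icc (0 : ℝ) ε := fun x =>
    ⟨le_max_left _ _, max_le h.eps_pos.le (min_le_right _ _)⟩
  have hφmono : Monotone φ := fun x y hxy => by simp only [φ]; gcongr
  have hD : ∀ x, |φ x| ≤ ε := fun x => by rw [abs_of_nonneg (hφmem x).1]; exact (hφmem x).2
  have hlow : ∀ x ∈ Ioc 0 (1 - gap T c / 2),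
      φ (T x - a * σ n x) ≤ stepOp (extMap T c) (extAmp T c (σ n)) χ φ x := by
    intro x hx
    have hxI : x ∈ stateSpace T c := hS.core_subset ⟨by linarith [hx.1, hS.map.gap_pos], hx.2⟩
    refine (stepOp_mem_Icc_of_reach (M := ε) hS.bump hS.a_pos hφ hD fun u hu => ?_).1
    rw [ext_step_eq hxI]
    exact ⟨hφmono (hS.lower_le hxI hu), (hφmem _).2⟩
  have hlt : ∀ x ∈ Ioo 0 ε, φ x < φ (T x - a * σ n x) := by
    intro x hx
    have h1 := h.lower_gt_self x hx
    simp only [φ]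
    rw [min_eq_left hx.2.le, max_eq_right hx.1.le]
    exact lt_max_of_lt_right (lt_min h1 hx.2)
  have hle : ∀ᵐ x ∂ν, φ x ≤ stepOp (extMap T c) (extAmp T c (σ n)) χ φ x := by
    filter_upwards [hcore, hnonneg, hne] with x hx hx0 hxne
    have hxpos : 0 < x := lt_of_le_of_ne hx0 hxne.symm
    refine le_trans ?_ (hlow x ⟨hxpos, hx.2⟩)
    rcases lt_or_ge x ε with hxε | hxε
    · exact (hlt x ⟨hxpos, hxε⟩).le
    · refine (hφmem x).2.trans ?_
      exact le_max_of_le_right (le_min (hS.eps_le_lower h ⟨hxε, hx.2⟩) le_rfl)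
  filter_upwards [hS.stepOp_ae_eq_of_le hν hφ hD hle, hcore, hnonneg, hne] with x hx hxc hx0 hxne
  have hxpos : 0 < x := lt_of_le_of_ne hx0 hxne.symm
  refine ⟨?_, hxc.2⟩
  by_contra! hxε
  exact ((hlt x ⟨hxpos, hxε⟩).trans_le (hlow x ⟨hxpos, hxc.2⟩)).ne hx

end FixedOrigin

/-! ### The case of a positive intercept -/

section PositiveIntercept

variable (h : PositiveInterceptCase T c (σ n) a)

include h

/-- Take `α` as the minimum of `T - a σ` on the compact core. To the right of `0` it is positive by
`lower_pos`; at or left of `0`, `T x ≥ T 0` while `a σ ≤ T 0 / 2`. Finally `α ≤ d₁` because `d₁` is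
a value of `T` on the core. -/
theorem exists_lower_bound : ∃ α, 0 < α ∧ α < 1 - gap T c / 2 ∧ α ≤ d₁ ∧
    ∀ x ∈ Icc (-(gap T c / 2)) (1 - gap T c / 2), ∀ u ∈ Icc (-a) a,
      T x + σ n x * u ∈ Icc α (1 - gap T c / 2) := by
  have hΓ := hS.map.gap_pos
  have hΓ1 := hS.map.gap_le_one
  obtain ⟨x₀, hx₀, hmin⟩ := (isCompact_Icc (a := -(gap T c / 2))
    (b := 1 - gap T c / 2)).exists_isMinOn (nonempty_Icc.2 (by linarith)) (hS.lower_continuousOn.mono hS.core_subset)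
  set α := T x₀ - a * σ n x₀ with hα
  have hmin' : ∀ x ∈ Icc (-(gap T c / 2)) (1 - gap T c / 2), α ≤ T x - a * σ n x := hmin
  have hX : ∀ x ∈ Icc d₁ d₂, x ∈ Icc (-(gap T c / 2)) (1 - gap T c / 2) := fun x hx =>
    ⟨by linarith [(hS.map.subset hx).1], hx.2.trans (hS.map.right_le.trans hS.map.max_lt.le)⟩
  have hleT : ∀ x ∈ Icc (-(gap T c / 2)) (1 - gap T c / 2), α ≤ T x := fun x hx => by
    linarith [hmin' x hx, mul_nonneg hS.a_pos.le (hS.amp_nonneg (hS.core_subset hx))]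
  refine ⟨α, ?_, ?_, ?_, fun x hx u hu =>
    ⟨(hmin' x hx).trans (hS.lower_le (hS.core_subset hx) hu),
      (hS.step_mem (hS.core_subset hx) hu).2⟩⟩
  · rcases lt_or_ge 0 x₀ with hx | hx
    · exact h.lower_pos x₀ ⟨hx, hx₀.2⟩
    · have hxI := hS.core_subset hx₀
      have h1 := hS.mul_amp_le_of_bound h.bound hxI
      have h2 := h1.trans ((min_le_right _ _).trans (min_le_left _ _))
      have h3 := hS.map.map_zero_le ⟨hxI.1, hx⟩
      linarith [h.map_zero_pos]
  · exact ((hleT x₀ hx₀).trans (hS.map.map_mem (hS.core_subset hx₀)).2).trans_lt hS.map.max_lt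
  · obtain ⟨x, hx, hxd⟩ := hS.map.exists_preimage ⟨le_rfl, hS.map.lt.le⟩
    exact hxd ▸ hleT x (hX x hx)

end PositiveIntercept

/-! ### From the invariant interval to the whole state space -/

theorem ae_mem_of_core_enters {α : ℝ} (hinv : ∀ x ∈ Icc (-(gap T c / 2)) (1 - gap T c / 2),
      ∀ u ∈ Icc (-a) a, T x + σ n x * u ∈ Icc α (1 - gap T c / 2))
    {ν : Measure ℝ} (hν : IsStationary T c (σ n) χ ν) :
    ∀ᵐ x ∂ν, x ∈ Icc α (1 - gap T c / 2) := by
  refine hS.ae_mem_of_iterate_eq_zero hν measurableSet_Icc 2 fun x hx => ?_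
  rw [Function.iterate_succ_apply', Function.iterate_one, stepOp, integral_eq_zero_of_ae]
  filter_upwards [hS.bump.ae_mem] with u hu
  have hy := hS.step_mem hx hu
  rw [ext_step_eq hx, stepOp, integral_eq_zero_of_ae]
  · rfl
  filter_upwards [hS.bump.ae_mem] with v hv
  rw [ext_step_eq (hS.core_subset hy), indicator_of_notMem]
  · rfl
  · exact not_not.2 (hinv _ hy v hv)

theorem convergesOn_stateSpace {α : ℝ} (hinv : ∀ x ∈ Icc (-(gap T c / 2)) (1 - gap T c / 2),
      ∀ u ∈ Icc (-a) a, T x + σ n x * u ∈ Icc α (1 - gap T c / 2))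
    {μ : Measure ℝ} [IsProbabilityMeasure μ]
    (hconv : ConvergesOn T c (σ n) χ μ (Icc α (1 - gap T c / 2))) :
    ConvergesOn T c (σ n) χ μ (stateSpace T c) := by
  have hprob := hS.bump.isProbabilityMeasure hS.a_pos
  have hTm := hS.map.measurable_extMap
  have hsm := hS.measurable_extAmp
  obtain ⟨r, C, hr, hr1, hC, hdec⟩ := hconv
  -- The chain needs two steps, to the core and then to `[α, 1 - Γ/2]`, which costs `r⁻²`; the
  -- summand `2` covers `t < 2` by the trivial bound `2 * D`.
  refine ⟨r, (C + 2) / r ^ 2, hr, hr1, by positivity, fun φ D hφ hD t x hx => ?_⟩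
  have hD0 : 0 ≤ D := (abs_nonneg _).trans (hD 0)
  set l := ∫ y, φ y ∂μ
  set Q := stepOp (extMap T c) (extAmp T c (σ n)) χ
  have hl : |l| ≤ D := by
    have := norm_integral_le_of_norm_le_const (μ := μ) (f := φ) (ae_of_all _ hD)
    simpa using this
  rcases lt_or_ge t 2 with ht | ht
  · have h0 : |Q^[t] φ x| ≤ D := abs_iterate_stepOp_le hD t x
    have h1 : |Q^[t] φ x - l| ≤ 2 * D := (abs_sub _ _).trans (by linarith)
    have h2 : r ^ 2 ≤ r ^ t := pow_le_pow_of_le_one hr.le hr1.le ht.le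
    calc |Q^[t] φ x - l| ≤ 2 * D := h1
      _ ≤ (C + 2) * D := by gcongr; linarith
      _ = (C + 2) / r ^ 2 * r ^ 2 * D := by field_simp
      _ ≤ (C + 2) / r ^ 2 * r ^ t * D := by gcongr
  · obtain ⟨k, rfl⟩ := Nat.exists_eq_add_of_le ht
    set e := C * r ^ k * D
    have hmeas := measurable_iterate_stepOp (χ := χ) hTm hsm hφ k
    have hbd := abs_iterate_stepOp_le (T := extMap T c) (s := extAmp T c (σ n)) (χ := χ) hD k
    have hJ : ∀ y ∈ Icc α (1 - gap T c / 2), Q^[k] φ y ∈ Icc (l - e) (l + e) := by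
      intro y hy
      have := abs_le.1 (hdec φ D hφ hD k y hy)
      exact ⟨by linarith [this.1], by linarith [this.2]⟩
    have hcore : ∀ y ∈ Icc (-(gap T c / 2)) (1 - gap T c / 2),
        Q (Q^[k] φ) y ∈ Icc (l - e) (l + e) := fun y hy =>
      stepOp_mem_Icc_of_reach hS.bump hS.a_pos hmeas hbd fun u hu => by
        rw [ext_step_eq (hS.core_subset hy)]
        exact hJ _ (hinv y hy u hu)
    have hfin : Q (Q (Q^[k] φ)) x ∈ Icc (l - e) (l + e) :=
      stepOp_mem_Icc_of_reach hS.bump hS.a_pos (measurable_stepOp hTm hsm hmeas)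
        (abs_stepOp_le hbd) fun u hu => by
        rw [ext_step_eq hx]
        exact hcore _ (hS.step_mem hx hu)
    rw [Function.iterate_add_apply]
    have h1 : |Q (Q (Q^[k] φ)) x - l| ≤ e :=
      abs_le.2 ⟨by linarith [hfin.1], by linarith [hfin.2]⟩
    refine h1.trans ?_
    calc e ≤ (C + 2) * r ^ k * D := by simp only [e]; gcongr; linarith
      _ = (C + 2) / r ^ 2 * r ^ (2 + k) * D := by rw [pow_add]; field_simp

end IsRandomSystem

end

end HeteroChain

/-! ### The main theorem -/

open HeteroChain in
theorem mainTheorem1 (T : ℝ → ℝ) (c d₁ d₂ : ℝ) (σ : ℕ → ℝ → ℝ) (χ : ℝ → ℝ) (a : ℝ) (n : ℕ)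
    (hS : IsRandomSystem T c d₁ d₂ σ χ a n) :
    ∃ (μ : Measure ℝ) (h : ℝ → ℝ),
      IsStationary T c (σ n) χ μ ∧
      (∀ ν : Measure ℝ, IsStationary T c (σ n) χ ν → (T 0 = 0 → ν {0} = 0) → ν = μ) ∧
      (∀ x, 0 ≤ h x) ∧
      BoundedVariationOn h (stateSpace T c) ∧
      μ = (volume.restrict (stateSpace T c)).withDensity (fun x => ENNReal.ofReal (h x)) ∧
      Icc d₁ d₂ ⊆ μ.support ∧
      (∀ ε, FixedOriginCase T c (σ n) a ε →
        ExponentialDecayOn T c (σ n) χ μ (Icc ε (1 - gap T c / 2))) ∧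
      (PositiveInterceptCase T c (σ n) a →
        ExponentialDecayOn T c (σ n) χ μ (stateSpace T c)) := by
  rcases hS.cases with ⟨ε, hε⟩ | hpos
  · have hex := fun (ε : ℝ) (hε : FixedOriginCase T c (σ n) a ε) =>
      hS.exists_stationary hε.eps_pos hε.eps_lt (hS.eps_le_left hε)
        fun x hx u hu => hS.eps_invariant hε hx hu
    obtain ⟨μ, ρ, hnn, hbv, hμ, hstat, hsupp, hconv⟩ := hex ε hε
    have hp := hstat.prob
    have huniq : ∀ ν : Measure ℝ, IsStationary T c (σ n) χ ν → (T 0 = 0 → ν {0} = 0) → ν = μ :=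
      fun ν hν h0 => hS.eq_of_convergesOn hconv hν (hS.ae_mem_eps hε hν (h0 hε.map_zero))
    refine ⟨μ, ρ, hstat, huniq, hnn, hbv, hμ, hsupp, fun ε' hε' => ?_, fun hpos => ?_⟩
    · obtain ⟨μ', ρ', -, -, hμ', hstat', -, hconv'⟩ := hex ε' hε'
      -- Each admissible `ε'` yields its own stationary measure; being absolutely continuous it
      -- gives no mass to `0`, so uniqueness identifies it with `μ`.
      have hac : μ' ≪ volume := hμ' ▸
        (withDensity_absolutelyContinuous _ _).trans Measure.restrict_le_self.absolutelyContinuous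
      have heq : μ' = μ := huniq μ' hstat' fun _ => hac (by simp)
      rw [heq] at hconv'
      exact hS.exponentialDecayOn hε'.eps_lt (hS.eps_subset hε') hconv'
    · exact absurd hε.map_zero hpos.map_zero_pos.ne'
  · obtain ⟨α, hα, hαβ, hαd, hinv⟩ := hS.exists_lower_bound hpos
    obtain ⟨μ, ρ, hnn, hbv, hμ, hstat, hsupp, hconv⟩ := hS.exists_stationary hα hαβ hαd
      fun x hx u hu => hinv x ⟨by linarith [hx.1, hS.map.gap_pos], hx.2⟩ u hu
    have hp := hstat.prob
    refine ⟨μ, ρ, hstat, fun ν hν _ => ?_, hnn, hbv, hμ, hsupp, fun ε hε => ?_, fun _ => ?_⟩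
    · exact hS.eq_of_convergesOn hconv hν (hS.ae_mem_of_core_enters hinv hν)
    · exact absurd hε.map_zero hpos.map_zero_pos.ne'
    · exact hS.exponentialDecayOn (by linarith [hS.map.gap_pos]) subset_rfl
        (hS.convergesOn_stateSpace hinv hconv)
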